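/- **Theorem 2.2 (curvature pinch).** Let $\alpha\in[1,2]$, let $M$ be a compact smooth surface without boundary (for instance $M=S^2$), let $T>0$, and let $X:M\times[0,T)\to\mathbb{R}^3$ be a smooth (up to $t=0$) family of smooth embeddings $X_t=X(\cdot,t)$ such that each $M_t=X_t(M)$ is a strictly convex surface, i.e. $M_t$ is the boundary of a convex body and its second fundamental form is positive definite at every point. Suppose that $$\frac{\partial X}{\partial t}(x,t)=-K(x,t)^{\alpha/2}\,\nu(x,t)\qquad (x\in M,\ 0\le t<T),$$ where $K(x,t)$ and $\nu(x,t)$ are the Gauss curvature and the outer unit normal of $M_t$ at $X(x,t)$ (at $t=0$ the time derivative is one-sided). Let $r_1(x,t),r_2(x,t)>0$ be the principal radii of curvature of $M_t$ at $X(x,t)$, i.e. the reciprocals of the principal curvatures. Then the function $$t\longmapsto \sup_{x\in M}\frac{(r_1(x,t)-r_2(x,t))^2}{(r_1(x,t)\,r_2(x,t))^{\alpha}}$$ is finite and non-increasing on $[0,T)$. In particular, for all $t\in[0,T)$, $$\sup_{x\in M}\frac{(r_1(x,t)-r_2(x,t))^2}{(r_1(x,t)\,r_2(x,t))^{\alpha}}\le\sup_{x\in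 M}\frac{(r_1(x,0)-r_2(x,0))^2}{(r_1(x,0)\,r_2(x,0))^{\alpha}} .$$ -/

import Mathlib

open Set
open scoped Manifold ContDiff

noncomputable section

namespace GaussFlow

/-- Euclidean three-space. -/
abbrev E3 : Type := EuclideanSpace ℝ (Fin 3)

variable {M : Type*} [TopologicalSpace M] [ChartedSpace (EuclideanSpace ℝ (Fin 2)) M]

/-- The differential at `x` of a map `f` from the surface `M` to three-space. -/
abbrev diff (f : M → E3) (x : M) : TangentSpace (𝓡 2) x →L[ℝ] E3 :=
  mvfderiv (𝓡 2) f x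

instance (x : M) : FiniteDimensional ℝ (TangentSpace (𝓡 2) x) :=
  inferInstanceAs (FiniteDimensional ℝ (EuclideanSpace ℝ (Fin 2)))

/-- `n` is the outer unit normal at `X x` of the convex surface `X(M)`: a unit vector orthogonal to
the tangent plane, such that the whole surface lies on the side of that plane opposite to `n`. -/
structure IsOuterUnitNormal (X : M → E3) (x : M) (n : E3) : Prop where
  norm_eq_one : ‖n‖ = 1
  orthogonal : ∀ v : TangentSpace (𝓡 2) x, inner ℝ (diff X x v) n = 0
  outward : ∀ y : M, inner ℝ (X y - X x) n ≤ 0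

/-- The outer unit normal of a convex surface (an arbitrary vector where there is none). -/
def outerUnitNormal (X : M → E3) (x : M) : E3 :=
  Classical.epsilon (IsOuterUnitNormal X x)

/-- The Weingarten map (shape operator) `W` at `x`, which is determined by `dX ∘ W = dν`, where `ν`
is the outer unit normal; with this sign the round sphere of radius `ρ` has `W = ρ⁻¹ • id`. -/
def weingartenMap (X : M → E3) (x : M) :
    TangentSpace (𝓡 2) x →ₗ[ℝ] TangentSpace (𝓡 2) x :=
  Classical.epsilon fun W => ∀ v, diff X x (W v) = diff (outerUnitNormal X) x v

/-- The second fundamental form with respect to the outer unit normal. -/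
def secondFundamentalForm (X : M → E3) (x : M) (v w : TangentSpace (𝓡 2) x) : ℝ :=
  inner ℝ (diff (outerUnitNormal X) x v) (diff X x w)

/-- The Gauss curvature. -/
def gaussCurvature (X : M → E3) (x : M) : ℝ :=
  LinearMap.det (weingartenMap X x)

/-- The principal curvatures in increasing order: the eigenvalues of the Weingarten map, listed with
their algebraic multiplicity. -/
def principalCurvatures (X : M → E3) (x : M) : List ℝ :=
  (weingartenMap X x).charpoly.roots.sort (· ≤ ·)

/-- The smaller principal radius of curvature, the reciprocal of the larger principal curvature. -/
def r₁ (X : M → E3) (x : M) : ℝ := ((principalCurvatures X x).getD 1 0)⁻¹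

/-- The larger principal radius of curvature, the reciprocal of the smaller principal curvature. -/
def r₂ (X : M → E3) (x : M) : ℝ := ((principalCurvatures X x).getD 0 0)⁻¹

/-- The quantity `(r₁ - r₂)² / (r₁ r₂)^α`. -/
def pinching (α : ℝ) (X : M → E3) (x : M) : ℝ :=
  (r₁ X x - r₂ X x) ^ 2 / (r₁ X x * r₂ X x) ^ α

/-- `X` embeds `M` as a strictly convex surface: the image is the boundary of a convex body, and the
second fundamental form is positive definite everywhere. (Smoothness of `X` is required
separately, in `IsSolution`.) -/
structure IsStrictlyConvexEmbedding (X : M → E3) : Prop where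
  isEmbedding : Topology.IsEmbedding X
  immersion : ∀ x : M, Function.Injective (diff X x)
  convex : ∃ C : Set E3, Convex ℝ C ∧ IsCompact C ∧ (interior C).Nonempty ∧ range X = frontier C
  posDef : ∀ (x : M) (v : TangentSpace (𝓡 2) x), v ≠ 0 → 0 < secondFundamentalForm X x v v

/-- `X t`, `0 ≤ t < T`, is a smooth, strictly convex solution of `∂X/∂t = -K^{α/2} ν`; the
smoothness is joint in space and time and holds up to the initial time, where the time derivative
is the one-sided one. -/
structure IsSolution (α T : ℝ) (X : ℝ → M → E3) : Prop where
  smooth : ContMDiffOn ((𝓡 2).prod 𝓘(ℝ, ℝ)) 𝓘(ℝ, E3) ∞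
    (fun p : M × ℝ => X p.2 p.1) (univ ×ˢ Ico 0 T)
  strictlyConvex : ∀ t ∈ Ico 0 T, IsStrictlyConvexEmbedding (X t)
  flow : ∀ t ∈ Ico 0 T, ∀ x : M,
    HasDerivWithinAt (fun τ => X τ x)
      (-((gaussCurvature (X t) x) ^ (α / 2)) • outerUnitNormal (X t) x) (Ico 0 T) t

end GaussFlow

end

/-!
In terms of the principal curvatures, the pinching quantity is `Q = (κ₁ - κ₂)² K ^ (α - 2)`, a
continuous function of the mean curvature `H = κ₁ + κ₂` and the Gauss curvature `K > 0`. So `Q` is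
continuous on `M × [0, T)` and its supremum over `M` is finite. That the supremum does not increase
is a parabolic maximum principle.

The principle is applied to `Q - ε t` on `M × [a, b]`, for `ε > 0`. Suppose that the maximum is
attained at `(x, t)` with `t > a`. Then `Q > 0` there, so `x` is not umbilic. Near `(x, t)` the flow
is the graph of a smooth function `u` over the tangent plane at that point
(`IsSolution.exists_graph`), and the coordinate axes may be taken along the principal directions.
The flow becomes a scalar equation, which expresses `∂ₜ u` by the first and second space derivatives
of `u` (`IsGraphAt.time_derivative`), and `G = log Q` is another expression of that kind
(`IsGraphAt.pinching_eq_exp`). At the point itself `Du = 0`, and the Hessian is `diag(κ₁, κ₂)`.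

The heart of the proof is a computation at this point (`time_derivative_nonpos`). Let `β = α / 2`.
The equation determines `∂ₜ D²u` from the space derivatives of `u` up to order four. Once the first
order conditions `G₁ = G₂ = 0` of a maximum in space are used, `∂ₜ G` is `K ^ β` times the sum of
`β (G₁₁ / κ₁ + G₂₂ / κ₂)` and a quadratic form in the third derivatives; no terms in `κ₁`, `κ₂`
alone remain. At a maximum `G₁₁` and `G₂₂` are nonpositive, and the quadratic form is
nonpositive because `1 / 2 ≤ β ≤ 1` (`gradient_terms_nonpos`). Hence `∂ₜ Q ≤ 0`, whereas `∂ₜ Q ≥ ε`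
at a maximum over the past. This contradiction (`IsSolution.nonpos_of_isMax`) shows that the maximum
is attained at time `a`, and the theorem follows on letting `ε → 0`.

The derivatives along the axes are computed with 2-jets of functions of one variable (`HasJet`). As
the outer normal is defined by a choice, its regularity has to come from the convex geometry:
locally it is the normalized component, orthogonal to the tangent plane, of a fixed vector
(`IsSolution.normalInChart_regular`). This also gives the continuity of `Q` up to the initial time
(`IsSolution.continuousOn_pinching`).
-/

namespace GaussFlow

open Filter Topology

/-! ### Second order jets of functions of one variable -/

/-- `f` takes the value `a` at `x` and has first derivative `b` and second derivative `c` there.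
Existence of the second derivative at `x` includes differentiability of `f` near `x`. -/
def HasJet (f : ℝ → ℝ) (x a b c : ℝ) : Prop :=
  f x = a ∧ ∃ f' : ℝ → ℝ, (∀ᶠ s in 𝓝 x, HasDerivAt f (f' s) s) ∧ f' x = b ∧ HasDerivAt f' c x

namespace HasJet

variable {f g : ℝ → ℝ} {x a b c a' b' c' : ℝ}

lemma hasDerivAt (h : HasJet f x a b c) : HasDerivAt f b x := by
  obtain ⟨-, f', hf', rfl, -⟩ := h
  exact hf'.self_of_nhds

lemma congr (h : HasJet f x a b c) (ha : a = a') (hb : b = b') (hc : c = c') :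
    HasJet f x a' b' c' := by
  subst ha hb hc; exact h

lemma const (k : ℝ) : HasJet (fun _ => k) x k 0 0 :=
  ⟨rfl, fun _ => 0, .of_forall fun s => hasDerivAt_const s k, rfl, hasDerivAt_const x 0⟩

lemma add (hf : HasJet f x a b c) (hg : HasJet g x a' b' c') :
    HasJet (fun s => f s + g s) x (a + a') (b + b') (c + c') := by
  obtain ⟨rfl, f', hf', rfl, hf''⟩ := hf
  obtain ⟨rfl, g', hg', rfl, hg''⟩ := hg
  exact ⟨rfl, fun s => f' s + g' s, by
    filter_upwards [hf', hg'] with s h1 h2 using h1.add h2, rfl, hf''.add hg''⟩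

lemma mul (hf : HasJet f x a b c) (hg : HasJet g x a' b' c') :
    HasJet (fun s => f s * g s) x (a * a') (b * a' + a * b') (c * a' + 2 * b * b' + a * c') := by
  obtain ⟨rfl, f', hf', rfl, hf''⟩ := hf
  obtain ⟨rfl, g', hg', rfl, hg''⟩ := hg
  refine ⟨rfl, fun s => f' s * g s + f s * g' s, by
    filter_upwards [hf', hg'] with s h1 h2 using h1.mul h2, rfl, ?_⟩
  convert! (hf''.mul hg'.self_of_nhds).add (hf'.self_of_nhds.mul hg'') using 1
  ring

lemma const_mul (k : ℝ) (hf : HasJet f x a b c) :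
    HasJet (fun s => k * f s) x (k * a) (k * b) (k * c) :=
  ((const k).mul hf).congr rfl (by ring) (by ring)

lemma sub (hf : HasJet f x a b c) (hg : HasJet g x a' b' c') :
    HasJet (fun s => f s - g s) x (a - a') (b - b') (c - c') := by
  have := hf.add (hg.const_mul (-1))
  simpa [sub_eq_add_neg] using this

lemma log (hf : HasJet f x a b c) (ha : a ≠ 0) :
    HasJet (fun s => Real.log (f s)) x (Real.log a) (b / a) (c / a - (b / a) ^ 2) := by
  obtain ⟨rfl, f', hf', rfl, hf''⟩ := hf
  have hne : ∀ᶠ s in 𝓝 x, f s ≠ 0 := hf'.self_of_nhds.continuousAt.eventually_ne ha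
  refine ⟨rfl, fun s => f' s / f s, ?_, rfl, ?_⟩
  · filter_upwards [hf', hne] with s h1 h2 using h1.log h2
  · convert! hf''.div hf'.self_of_nhds ha using 1
    field_simp

lemma exp (hf : HasJet f x a b c) :
    HasJet (fun s => Real.exp (f s)) x (Real.exp a) (Real.exp a * b)
      (Real.exp a * (c + b ^ 2)) := by
  obtain ⟨rfl, f', hf', rfl, hf''⟩ := hf
  refine ⟨rfl, fun s => Real.exp (f s) * f' s, ?_, rfl, ?_⟩
  · filter_upwards [hf'] with s h1 using h1.exp
  · convert! hf'.self_of_nhds.exp.mul hf'' using 1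
    ring

lemma deriv_deriv (hf : HasJet f x a b c) : deriv (deriv f) x = c := by
  obtain ⟨-, f', hf', -, hf''⟩ := hf
  have h : deriv f =ᶠ[𝓝 x] f' := by filter_upwards [hf'] with s hs using hs.deriv
  rw [h.deriv_eq, hf''.deriv]

/-- The necessary conditions of first and second order at a local maximum. -/
lemma of_isLocalMax (hf : HasJet f x a b c) (hmax : IsLocalMax f x) : b = 0 ∧ c ≤ 0 := by
  have hb : b = 0 := hmax.hasDerivAt_eq_zero hf.hasDerivAt
  refine ⟨hb, ?_⟩
  by_contra! hc
  -- If `c > 0`, then `f - (c / 4) (· - x) ^ 2` still has a strict second order minimum at `x`.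
  have hid : HasJet (fun s => s - x) x 0 1 0 :=
    ⟨by simp, fun _ => 1, .of_forall fun s => (hasDerivAt_id s).sub_const x, rfl,
      hasDerivAt_const x 1⟩
  have hg := hf.sub ((hid.mul hid).const_mul (c / 4))
  have hmin := isLocalMin_of_deriv_deriv_pos (x₀ := x)
    (f := fun s => f s - c / 4 * ((s - x) * (s - x)))
    (by rw [hg.deriv_deriv]; linarith)
    (by rw [hg.hasDerivAt.deriv, hb]; ring) hg.hasDerivAt.continuousAt
  have hev : ∀ᶠ s in 𝓝[≠] x, False := by
    filter_upwards [hmin.filter_mono nhdsWithin_le_nhds, hmax.filter_mono nhdsWithin_le_nhds,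
      self_mem_nhdsWithin] with s h1 h2 h3
    have h4 : 0 < (s - x) * (s - x) := mul_self_pos.2 (sub_ne_zero.2 h3)
    have h5 : f x ≤ f s - c / 4 * ((s - x) * (s - x)) := by simpa using h1
    nlinarith
  exact (NeBot.ne inferInstance) (eventually_false_iff_eq_bot.1 hev)

end HasJet

/-! ### Iterated directional derivatives -/

section DirectionalDerivatives

variable {E F : Type*} [NormedAddCommGroup E] [NormedSpace ℝ E] [NormedAddCommGroup F]
  [NormedSpace ℝ F]

/-- The directional derivative of `f` in the direction `v`, as a function of the base point. -/
noncomputable def pd (v : E) (f : E → F) (p : E) : F := fderiv ℝ f p v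

lemma contDiffAt_pd {n : ℕ} {f : E → F} {p : E} (v : E)
    (h : ContDiffAt ℝ ((n + 1 : ℕ) : ℕ∞ω) f p) : ContDiffAt ℝ (n : ℕ∞ω) (pd v f) p :=
  (h.fderiv_right (m := (n : ℕ∞ω)) (by push_cast; exact le_rfl)).clm_apply contDiffAt_const

lemma pd_comm {f : E → F} {p : E} (v w : E) (h : ContDiffAt ℝ 2 f p) :
    pd v (pd w f) p = pd w (pd v f) p := by
  have hd : DifferentiableAt ℝ (fderiv ℝ f) p :=
    (h.fderiv_right (m := 1) (by norm_num [one_add_one_eq_two])).differentiableAt (by norm_num)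
  have hsymm : IsSymmSndFDerivAt ℝ f p := h.isSymmSndFDerivAt (by simp)
  have key : ∀ v w : E, pd v (pd w f) p = fderiv ℝ (fderiv ℝ f) p v w := by
    intro v w
    have := (hd.hasFDerivAt.clm_apply (hasFDerivAt_const w p)).fderiv
    change fderiv ℝ (fun q => fderiv ℝ f q w) p v = _
    rw [this]; simp
  rw [key, key, hsymm.eq]

lemma pd_congr {f g : E → F} {p : E} (v : E) (h : f =ᶠ[𝓝 p] g) : pd v f =ᶠ[𝓝 p] pd v g := by
  filter_upwards [eventually_eventually_nhds.2 h] with q hq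
  rw [pd, pd, Filter.EventuallyEq.fderiv_eq hq]

lemma pd_comm_eventuallyEq {f : E → F} {p : E} (v w : E) (h : ContDiffAt ℝ 2 f p) :
    pd v (pd w f) =ᶠ[𝓝 p] pd w (pd v f) := by
  filter_upwards [h.eventually (by simp)] with q hq using pd_comm v w hq

lemma hasDerivAt_line {f : E → ℝ} {p : E} (v : E) {s : ℝ} (h : DifferentiableAt ℝ f (p + s • v)) :
    HasDerivAt (fun s : ℝ => f (p + s • v)) (pd v f (p + s • v)) s := by
  have hl : HasDerivAt (fun s : ℝ => p + s • v) v s := by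
    simpa using ((hasDerivAt_id s).smul_const v).const_add p
  exact h.hasFDerivAt.comp_hasDerivAt s hl

lemma hasDerivAt_line_zero {f : E → ℝ} {p : E} (v : E) (h : DifferentiableAt ℝ f p) :
    HasDerivAt (fun s : ℝ => f (p + s • v)) (pd v f p) 0 := by
  have := hasDerivAt_line (f := f) (p := p) v (s := 0) (by simpa using h)
  simpa using this

lemma hasJet_line {f : E → ℝ} {p : E} (v : E) (h : ContDiffAt ℝ 2 f p) :
    HasJet (fun s : ℝ => f (p + s • v)) 0 (f p) (pd v f p) (pd v (pd v f) p) := by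
  refine ⟨by simp, fun s => pd v f (p + s • v), ?_, by simp, ?_⟩
  · have hcont : Tendsto (fun s : ℝ => p + s • v) (𝓝 0) (𝓝 p) := by
      have : Continuous fun s : ℝ => p + s • v := by fun_prop
      simpa using this.tendsto 0
    filter_upwards [hcont.eventually (h.eventually (by simp))] with s hs
    exact hasDerivAt_line v (hs.differentiableAt (by norm_num))
  · exact hasDerivAt_line_zero v
      ((contDiffAt_pd (n := 1) v (by exact_mod_cast h)).differentiableAt (by norm_num))

end DirectionalDerivatives

end GaussFlow

namespace GaussFlow

open Filter Topology

/-! ### Curvature of a graph -/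

/-- `1 + |Du|²` in terms of the gradient `(x, y)` of `u`. -/
noncomputable def areaSq (x y : ℝ) : ℝ := 1 + (x * x + y * y)

/-- The numerator of the mean curvature of a graph, in terms of the gradient `(x, y)` and the
second derivatives `p = u₁₁`, `q = u₁₂`, `r = u₂₂`. -/
noncomputable def meanNum (x y p q r : ℝ) : ℝ :=
  ((1 + y * y) * p + (1 + x * x) * r) - 2 * ((x * y) * q)

/-- The determinant of the Hessian with entries `p`, `q`, `r`. -/
noncomputable def hessDet (p q r : ℝ) : ℝ := p * r - q * q

/-- `(1 + |Du|²)³` times the squared difference of the principal curvatures of a graph. -/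
noncomputable def discNum (x y p q r : ℝ) : ℝ :=
  meanNum x y p q r * meanNum x y p q r - 4 * (areaSq x y * hessDet p q r)

/-- The logarithm of `(κ₁ - κ₂)² K ^ (2β - 2)`, the pinching quantity with exponent `α = 2β`, for a
graph. -/
noncomputable def logPinch (β x y p q r : ℝ) : ℝ :=
  (Real.log (discNum x y p q r) - 3 * Real.log (areaSq x y)) +
    (2 * β - 2) * (Real.log (hessDet p q r) - 2 * Real.log (areaSq x y))

/-- The logarithm of the vertical speed `√(1 + |Du|²) K ^ β` of a graph moving with normal speed
`K ^ β`. -/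
noncomputable def logSpeed (β x y p q r : ℝ) : ℝ :=
  (1 / 2) * Real.log (areaSq x y) + β * (Real.log (hessDet p q r) - 2 * Real.log (areaSq x y))

section Jets

variable {x y p q r : ℝ → ℝ} {a b x1 x2 y1 y2 p1 p2 q1 q2 r1 r2 : ℝ}

lemma hasJet_areaSq (hx : HasJet x 0 0 x1 x2) (hy : HasJet y 0 0 y1 y2) :
    HasJet (fun s => areaSq (x s) (y s)) 0 1 0 (2 * (x1 ^ 2 + y1 ^ 2)) :=
  ((HasJet.const 1).add ((hx.mul hx).add (hy.mul hy))).congr (by ring) (by ring) (by ring)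

lemma hasJet_hessDet (hp : HasJet p 0 a p1 p2) (hq : HasJet q 0 0 q1 q2)
    (hr : HasJet r 0 b r1 r2) :
    HasJet (fun s => hessDet (p s) (q s) (r s)) 0 (a * b) (a * r1 + b * p1)
      (b * p2 + a * r2 + 2 * p1 * r1 - 2 * q1 ^ 2) :=
  ((hp.mul hr).sub (hq.mul hq)).congr (by ring) (by ring) (by ring)

lemma hasJet_meanNum (hx : HasJet x 0 0 x1 x2) (hy : HasJet y 0 0 y1 y2) (hp : HasJet p 0 a p1 p2)
    (hq : HasJet q 0 0 q1 q2) (hr : HasJet r 0 b r1 r2) :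
    HasJet (fun s => meanNum (x s) (y s) (p s) (q s) (r s)) 0 (a + b) (p1 + r1)
      (p2 + r2 + 2 * y1 ^ 2 * a + 2 * x1 ^ 2 * b) :=
  (((((HasJet.const 1).add (hy.mul hy)).mul hp).add
    (((HasJet.const 1).add (hx.mul hx)).mul hr)).sub (((hx.mul hy).mul hq).const_mul 2)).congr
    (by ring) (by ring) (by ring)

lemma hasJet_discNum (hx : HasJet x 0 0 x1 x2) (hy : HasJet y 0 0 y1 y2) (hp : HasJet p 0 a p1 p2)
    (hq : HasJet q 0 0 q1 q2) (hr : HasJet r 0 b r1 r2) :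
    HasJet (fun s => discNum (x s) (y s) (p s) (q s) (r s)) 0 ((a - b) ^ 2)
      (2 * (a - b) * (p1 - r1))
      (2 * (a - b) * (p2 - r2) + 2 * (p1 - r1) ^ 2 + 8 * q1 ^ 2
        + 4 * (a + b) * (y1 ^ 2 * a + x1 ^ 2 * b) - 8 * (x1 ^ 2 + y1 ^ 2) * (a * b)) :=
  (((hasJet_meanNum hx hy hp hq hr).mul (hasJet_meanNum hx hy hp hq hr)).sub
    (((hasJet_areaSq hx hy).mul (hasJet_hessDet hp hq hr)).const_mul 4)).congr
    (by ring) (by ring) (by ring)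

lemma hasJet_logPinch (β : ℝ) (ha : a ≠ 0) (hb : b ≠ 0) (hab : a ≠ b)
    (hx : HasJet x 0 0 x1 x2) (hy : HasJet y 0 0 y1 y2) (hp : HasJet p 0 a p1 p2)
    (hq : HasJet q 0 0 q1 q2) (hr : HasJet r 0 b r1 r2) :
    HasJet (fun s => logPinch β (x s) (y s) (p s) (q s) (r s)) 0 (logPinch β 0 0 a 0 b)
      (2 * (p1 - r1) / (a - b) + (2 * β - 2) * (p1 / a + r1 / b))
      ((2 * (a - b) * (p2 - r2) + 2 * (p1 - r1) ^ 2 + 8 * q1 ^ 2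
        + 4 * (a + b) * (y1 ^ 2 * a + x1 ^ 2 * b) - 8 * (x1 ^ 2 + y1 ^ 2) * (a * b)) / (a - b) ^ 2
        - (2 * (p1 - r1) / (a - b)) ^ 2 - 6 * (x1 ^ 2 + y1 ^ 2)
        + (2 * β - 2) * ((b * p2 + a * r2 + 2 * p1 * r1 - 2 * q1 ^ 2) / (a * b)
          - (p1 / a + r1 / b) ^ 2 - 4 * (x1 ^ 2 + y1 ^ 2))) := by
  have hab' : a - b ≠ 0 := sub_ne_zero.2 hab
  have hv := (hasJet_areaSq hx hy).log one_ne_zero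
  have hD := (hasJet_hessDet hp hq hr).log (mul_ne_zero ha hb)
  have hR := (hasJet_discNum hx hy hp hq hr).log (pow_ne_zero 2 hab')
  refine ((hR.sub (hv.const_mul 3)).add
    ((hD.sub (hv.const_mul 2)).const_mul (2 * β - 2))).congr ?_ ?_ ?_
  · simp only [logPinch, discNum, meanNum, areaSq, hessDet]
    ring_nf
  · field_simp
    ring
  · field_simp
    ring

lemma hasJet_exp_logSpeed (β : ℝ) (ha : a ≠ 0) (hb : b ≠ 0)
    (hx : HasJet x 0 0 x1 x2) (hy : HasJet y 0 0 y1 y2) (hp : HasJet p 0 a p1 p2)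
    (hq : HasJet q 0 0 q1 q2) (hr : HasJet r 0 b r1 r2) :
    HasJet (fun s => Real.exp (logSpeed β (x s) (y s) (p s) (q s) (r s))) 0
      (Real.exp (logSpeed β 0 0 a 0 b))
      (Real.exp (logSpeed β 0 0 a 0 b) * (β * (p1 / a + r1 / b)))
      (Real.exp (logSpeed β 0 0 a 0 b) * ((x1 ^ 2 + y1 ^ 2)
        + β * ((b * p2 + a * r2 + 2 * p1 * r1 - 2 * q1 ^ 2) / (a * b)
          - (p1 / a + r1 / b) ^ 2 - 4 * (x1 ^ 2 + y1 ^ 2)) + (β * (p1 / a + r1 / b)) ^ 2)) := by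
  have hv := (hasJet_areaSq hx hy).log one_ne_zero
  have hD := (hasJet_hessDet hp hq hr).log (mul_ne_zero ha hb)
  have h0 : (1 / 2) * Real.log 1 + β * (Real.log (a * b) - 2 * Real.log 1)
      = logSpeed β 0 0 a 0 b := by
    simp only [logSpeed, areaSq, hessDet]
    ring_nf
  refine ((hv.const_mul (1 / 2)).add
    ((hD.sub (hv.const_mul 2)).const_mul β)).exp.congr ?_ ?_ ?_
  · rw [h0]
  · rw [h0]
    field_simp
    ring
  · rw [h0]
    field_simp
    ring

end Jets

/-! ### The gradient terms -/

/-- The gradient terms of one direction have a sign. Here `A` and `C` are the derivatives in that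
direction of the principal curvatures `a` and `b`, and `hm` says that the pinching quantity is
stationary in that direction. Solving `hm` for `m` in terms of `C` turns the claim into two
inequalities between multiples of `C ^ 2`; they need `β ≤ 1`, and the first also `1 / 2 ≤ β`. -/
lemma gradient_terms_nonpos {a b β A C m : ℝ} (ha : 0 < a) (hb : 0 < b) (hab : a ≠ b)
    (h1 : 1 / 2 ≤ β) (h2 : β ≤ 1) (hA : A - C = m * (a - b))
    (hm : m = (1 - β) * (A / a + C / b)) :
    2 / a ^ 2 * (b * m ^ 2 + (b - 3 * a) * m * (C / (a - b)) - 4 * a * (C / (a - b)) ^ 2) ≤ 0 := by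
  have hab' : a - b ≠ 0 := sub_ne_zero.2 hab
  obtain ⟨c, rfl⟩ : ∃ c, C = c * (a - b) := ⟨C / (a - b), by field_simp⟩
  obtain rfl : A = c * (a - b) + m * (a - b) := by linarith
  rw [mul_div_assoc, div_self hab', mul_one]
  set s := a - (1 - β) * (a - b) with hs
  have hs0 : 0 < s := by
    have h : s = β * a + (1 - β) * b := by rw [hs]; ring
    rw [h]
    have : 0 ≤ (1 - β) * b := mul_nonneg (by linarith) hb.le
    have : 0 < β * a := mul_pos (by linarith) ha
    linarith
  have hsm : s * b * m = (1 - β) * c * (a - b) * (a + b) := by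
    have : a * b * m = (1 - β) * ((c * (a - b) + m * (a - b)) * b + c * (a - b) * a) := by
      conv_lhs => rw [hm]
      field_simp
    rw [hs]
    linarith
  have hprod : (s ^ 2 * b) * (m * (m * b - c * (a - b))) ≤ 0 := by
    have : (s ^ 2 * b) * (m * (m * b - c * (a - b)))
        = -(1 - β) * (2 * β - 1) * (a * (a + b) * (c * (a - b)) ^ 2) := by
      have e1 : (s ^ 2 * b) * (m * (m * b - c * (a - b)))
        = (s * b * m) * (s * b * m - s * (c * (a - b))) := by ring
      rw [e1, hsm, hs]
      ring
    rw [this]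
    have : 0 ≤ (1 - β) * (2 * β - 1) := mul_nonneg (by linarith) (by linarith)
    have : 0 ≤ a * (a + b) * (c * (a - b)) ^ 2 := by positivity
    nlinarith
  have hle : m * (m * b - c * (a - b)) ≤ 0 := by
    by_contra! h
    have : 0 < (s ^ 2 * b) * (m * (m * b - c * (a - b))) := mul_pos (by positivity) h
    linarith
  have hcm : 0 ≤ c * (m + 2 * c) := by
    have : (s * b) * (c * (m + 2 * c))
        = c ^ 2 * ((1 - β) * (a ^ 2 + b ^ 2) + 2 * b * (β * a) ) := by
      have e1 : (s * b) * (c * (m + 2 * c)) = c * (s * b * m) + 2 * c ^ 2 * (s * b) := by ring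
      rw [e1, hsm, hs]
      ring
    have h3 : 0 ≤ (s * b) * (c * (m + 2 * c)) := by
      rw [this]
      have : 0 ≤ (1 - β) * (a ^ 2 + b ^ 2) := mul_nonneg (by linarith) (by positivity)
      have : 0 ≤ 2 * b * (β * a) := by have : 0 ≤ β := by linarith
                                       positivity
      positivity
    exact nonneg_of_mul_nonneg_right h3 (by positivity)
  have : b * m ^ 2 + (b - 3 * a) * m * c - 4 * a * c ^ 2 ≤ 0 := by
    have := mul_nonneg ha.le hcm
    nlinarith
  exact mul_nonpos_of_nonneg_of_nonpos (by positivity) this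

/-- The maximum principle computation at a point where the Hessian is diagonal: a nonnegative
combination of the second derivatives of the logarithm of the pinching quantity, plus gradient terms
with a sign, equals its time derivative. The terms without third or fourth derivatives cancel. -/
lemma time_derivative_nonpos {a b β A B C D f40 f22 f04 : ℝ} (ha : 0 < a) (hb : 0 < b)
    (hab : a ≠ b) (h1 : 1 / 2 ≤ β) (h2 : β ≤ 1)
    (hG1 : 2 * (A - C) / (a - b) + (2 * β - 2) * (A / a + C / b) = 0)
    (hG2 : 2 * (B - D) / (a - b) + (2 * β - 2) * (B / a + D / b) = 0)
    (hG11 : (2 * (a - b) * (f40 - f22) + 2 * (A - C) ^ 2 + 8 * B ^ 2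
        + 4 * (a + b) * (0 ^ 2 * a + a ^ 2 * b) - 8 * (a ^ 2 + 0 ^ 2) * (a * b)) / (a - b) ^ 2
        - (2 * (A - C) / (a - b)) ^ 2 - 6 * (a ^ 2 + 0 ^ 2)
        + (2 * β - 2) * ((b * f40 + a * f22 + 2 * A * C - 2 * B ^ 2) / (a * b)
          - (A / a + C / b) ^ 2 - 4 * (a ^ 2 + 0 ^ 2)) ≤ 0)
    (hG22 : (2 * (a - b) * (f22 - f04) + 2 * (B - D) ^ 2 + 8 * C ^ 2
        + 4 * (a + b) * (b ^ 2 * a + 0 ^ 2 * b) - 8 * (0 ^ 2 + b ^ 2) * (a * b)) / (a - b) ^ 2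
        - (2 * (B - D) / (a - b)) ^ 2 - 6 * (0 ^ 2 + b ^ 2)
        + (2 * β - 2) * ((b * f22 + a * f04 + 2 * B * D - 2 * C ^ 2) / (a * b)
          - (B / a + D / b) ^ 2 - 4 * (0 ^ 2 + b ^ 2)) ≤ 0)
    {P R : ℝ}
    (hP : P = (a ^ 2 + 0 ^ 2) + β * ((b * f40 + a * f22 + 2 * A * C - 2 * B ^ 2) / (a * b)
          - (A / a + C / b) ^ 2 - 4 * (a ^ 2 + 0 ^ 2)) + (β * (A / a + C / b)) ^ 2)
    (hR : R = (0 ^ 2 + b ^ 2) + β * ((b * f22 + a * f04 + 2 * B * D - 2 * C ^ 2) / (a * b)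
          - (B / a + D / b) ^ 2 - 4 * (0 ^ 2 + b ^ 2)) + (β * (B / a + D / b)) ^ 2) :
    2 * (P - R) / (a - b) + (2 * β - 2) * (P / a + R / b) ≤ 0 := by
  have hab' : a - b ≠ 0 := sub_ne_zero.2 hab
  obtain ⟨m, rfl⟩ : ∃ m, A = C + m * (a - b) := ⟨(A - C) / (a - b), by field_simp; ring⟩
  obtain ⟨n, rfl⟩ : ∃ n, D = B + n * (b - a) := ⟨(D - B) / (b - a), by
    have := sub_ne_zero.2 hab.symm
    field_simp
    ring⟩
  have hm : m = (1 - β) * ((C + m * (a - b)) / a + C / b) := by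
    have : 2 * (C + m * (a - b) - C) / (a - b) = 2 * m := by field_simp; ring
    linarith
  have hn : n = (1 - β) * ((B + n * (b - a)) / b + B / a) := by
    have : 2 * (B - (B + n * (b - a))) / (a - b) = 2 * n := by field_simp; ring
    linarith
  -- the second direction is the first one with `a` and `b` exchanged
  have S1 := gradient_terms_nonpos ha hb hab h1 h2 (by ring) hm
  have S2 := gradient_terms_nonpos hb ha hab.symm h1 h2 (by ring) hn
  have key : ∀ G11 G22 S1 S2 : ℝ,
      G11 = (2 * (a - b) * (f40 - f22) + 2 * (C + m * (a - b) - C) ^ 2 + 8 * B ^ 2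
        + 4 * (a + b) * (0 ^ 2 * a + a ^ 2 * b) - 8 * (a ^ 2 + 0 ^ 2) * (a * b)) / (a - b) ^ 2
        - (2 * (C + m * (a - b) - C) / (a - b)) ^ 2 - 6 * (a ^ 2 + 0 ^ 2)
        + (2 * β - 2) * ((b * f40 + a * f22 + 2 * (C + m * (a - b)) * C - 2 * B ^ 2) / (a * b)
          - ((C + m * (a - b)) / a + C / b) ^ 2 - 4 * (a ^ 2 + 0 ^ 2)) →
      G22 = (2 * (a - b) * (f22 - f04) + 2 * (B - (B + n * (b - a))) ^ 2 + 8 * C ^ 2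
        + 4 * (a + b) * (b ^ 2 * a + 0 ^ 2 * b) - 8 * (0 ^ 2 + b ^ 2) * (a * b)) / (a - b) ^ 2
        - (2 * (B - (B + n * (b - a))) / (a - b)) ^ 2 - 6 * (0 ^ 2 + b ^ 2)
        + (2 * β - 2) * ((b * f22 + a * f04 + 2 * B * (B + n * (b - a)) - 2 * C ^ 2) / (a * b)
          - (B / a + (B + n * (b - a)) / b) ^ 2 - 4 * (0 ^ 2 + b ^ 2)) →
      S1 = 2 / a ^ 2 * (b * m ^ 2 + (b - 3 * a) * m * (C / (a - b)) - 4 * a * (C / (a - b)) ^ 2) →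
      S2 = 2 / b ^ 2 * (a * n ^ 2 + (a - 3 * b) * n * (B / (b - a)) - 4 * b * (B / (b - a)) ^ 2) →
      2 * (P - R) / (a - b) + (2 * β - 2) * (P / a + R / b)
        = β / a * G11 + β / b * G22 + β * (S1 + S2) := by
    intro G11 G22 S1 S2 e1 e2 e3 e4
    obtain ⟨e, rfl⟩ : ∃ e, a = b + e := ⟨a - b, by ring⟩
    have he : e ≠ 0 := by simpa using hab'
    have ha' := ha.ne'
    have hb' := hb.ne'
    have hsub : b + e - b = e := by ring
    have hsub' : b - (b + e) = -e := by ring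
    subst e1 e2 e3 e4 hP hR
    rw [hsub] at hm
    rw [hsub'] at hn
    rw [hsub, hsub', ← sub_eq_zero]
    have hm' : m - (1 - β) * ((C + m * e) / (b + e) + C / b) = 0 := sub_eq_zero.2 hm
    have hn' : n - (1 - β) * ((B + n * -e) / b + B / (b + e)) = 0 := sub_eq_zero.2 hn
    clear hG1 hG2 hG11 hG22 S1 S2 hm hn hab hab' h1 h2
    -- the two sides differ by multiples of the first order conditions `hm'` and `hn'`
    trans -β * (2 * ((1 - β) * ((C + m * e) / (b + e) + C / b) + m) / (b + e)
          - ((C + m * e) / (b + e) + C / b) * (2 / e + 2 / (b + e)))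
          * (m - (1 - β) * ((C + m * e) / (b + e) + C / b))
        + -β * (2 * ((1 - β) * ((B + n * -e) / b + B / (b + e)) + n) / b
          - ((B + n * -e) / b + B / (b + e)) * (-(2 / e) + 2 / b))
          * (n - (1 - β) * ((B + n * -e) / b + B / (b + e)))
    · field_simp
      ring
    · rw [hm', hn']
      ring
  rw [key _ _ _ _ rfl rfl rfl rfl]
  have hβ : 0 ≤ β := by linarith
  have t1 := mul_nonpos_of_nonneg_of_nonpos (div_nonneg hβ ha.le) hG11
  have t2 := mul_nonpos_of_nonneg_of_nonpos (div_nonneg hβ hb.le) hG22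
  have t3 := mul_nonpos_of_nonneg_of_nonpos hβ (add_nonpos S1 S2)
  linarith

end GaussFlow

namespace GaussFlow

open Filter Topology

/-! ### The pointwise inequality for a moving graph -/

/-- The first space direction in `ℝ × ℝ × ℝ`, whose last factor is time. -/
def ex : ℝ × ℝ × ℝ := (1, 0, 0)

/-- The second space direction in `ℝ × ℝ × ℝ`. -/
def ey : ℝ × ℝ × ℝ := (0, 1, 0)

/-- The time direction in `ℝ × ℝ × ℝ`. -/
def et : ℝ × ℝ × ℝ := (0, 0, 1)

/-- An expression in the space derivatives of first and second order of `u`, evaluated along `u`. -/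
noncomputable def onJet (Φ : ℝ → ℝ → ℝ → ℝ → ℝ → ℝ) (u : ℝ × ℝ × ℝ → ℝ) (z : ℝ × ℝ × ℝ) : ℝ :=
  Φ (pd ex u z) (pd ey u z) (pd ex (pd ex u) z) (pd ex (pd ey u) z) (pd ey (pd ey u) z)

/-- At a point where the graph of `u` is horizontal and has diagonal Hessian with distinct positive
entries, the time derivative of the pinching quantity is nonpositive if that quantity is
maximal along both coordinate axes. -/
theorem exists_hasDerivAt_logPinch_nonpos {u : ℝ × ℝ × ℝ → ℝ} {z : ℝ × ℝ × ℝ} {a b β : ℝ}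
    (hu : ContDiffAt ℝ 5 u z) (ha : 0 < a) (hb : 0 < b) (hab : a ≠ b) (h1 : 1 / 2 ≤ β) (h2 : β ≤ 1)
    (hx : pd ex u z = 0) (hy : pd ey u z = 0) (hxx : pd ex (pd ex u) z = a)
    (hxy : pd ex (pd ey u) z = 0) (hyy : pd ey (pd ey u) z = b)
    (hpde : pd et u =ᶠ[𝓝 z] fun w => Real.exp (onJet (logSpeed β) u w))
    (hmx : IsLocalMax (fun s : ℝ => onJet (logPinch β) u (z + s • ex)) 0)
    (hmy : IsLocalMax (fun s : ℝ => onJet (logPinch β) u (z + s • ey)) 0) :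
    ∃ d ≤ 0, HasDerivAt (fun s : ℝ => onJet (logPinch β) u (z + s • et)) d 0 := by
  have hu5 : ContDiffAt ℝ ((4 + 1 : ℕ) : ℕ∞ω) u z := hu
  have c1 : ∀ v, ContDiffAt ℝ (4 : ℕ) (pd v u) z := fun v => contDiffAt_pd v hu5
  have c2 : ∀ v w, ContDiffAt ℝ (3 : ℕ) (pd v (pd w u)) z := fun v w =>
    contDiffAt_pd (n := 3) v (c1 w)
  have le2 : ∀ {f : ℝ × ℝ × ℝ → ℝ} {n : ℕ}, 2 ≤ n → ContDiffAt ℝ (n : ℕ∞ω) f z →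
      ContDiffAt ℝ 2 f z := fun hn h => h.of_le (by exact_mod_cast hn)
  have k0 : ∀ v w, pd v (pd w u) =ᶠ[𝓝 z] pd w (pd v u) := fun v w =>
    pd_comm_eventuallyEq v w (hu.of_le (by norm_num))
  have k1 : ∀ v w x, pd v (pd w (pd x u)) =ᶠ[𝓝 z] pd w (pd v (pd x u)) := fun v w x =>
    pd_comm_eventuallyEq v w (le2 (by norm_num) (c1 x))
  have k2 : ∀ v w x y, pd v (pd w (pd x (pd y u))) z = pd w (pd v (pd x (pd y u))) z :=
    fun v w x y => pd_comm v w (le2 (by norm_num) (c2 x y))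
  -- third derivatives
  set A := pd ex (pd ex (pd ex u)) z
  set B := pd ex (pd ex (pd ey u)) z with hB
  set C := pd ex (pd ey (pd ey u)) z
  set D := pd ey (pd ey (pd ey u)) z
  have e211 : pd ey (pd ex (pd ex u)) z = B := by
    rw [(k1 ey ex ex).self_of_nhds, hB]
    exact (pd_congr ex (k0 ey ex)).self_of_nhds
  have e212 : pd ey (pd ex (pd ey u)) z = C := (k1 ey ex ey).self_of_nhds
  -- fourth derivatives
  set f40 := pd ex (pd ex (pd ex (pd ex u))) z
  set f22 := pd ex (pd ex (pd ey (pd ey u))) z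
  set f04 := pd ey (pd ey (pd ey (pd ey u))) z
  have e2211 : pd ey (pd ey (pd ex (pd ex u))) z = f22 := by
    have s1 : pd ey (pd ex (pd ex u)) =ᶠ[𝓝 z] pd ex (pd ex (pd ey u)) :=
      (k1 ey ex ex).trans (pd_congr ex (k0 ey ex))
    rw [(pd_congr ey s1).self_of_nhds, k2 ey ex ex ey]
    exact (pd_congr ex (k1 ey ex ey)).self_of_nhds
  -- jets along the first axis
  have X1 := (hasJet_line ex (le2 (by norm_num) (c1 ex))).congr hx hxx rfl
  have X2 := (hasJet_line ex (le2 (by norm_num) (c1 ey))).congr hy hxy rfl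
  have X3 := (hasJet_line ex (le2 (by norm_num) (c2 ex ex))).congr hxx rfl rfl
  have X4 := (hasJet_line ex (le2 (by norm_num) (c2 ex ey))).congr hxy rfl rfl
  have X5 := (hasJet_line ex (le2 (by norm_num) (c2 ey ey))).congr hyy rfl rfl
  -- jets along the second axis
  have Y1 := (hasJet_line ey (le2 (by norm_num) (c1 ex))).congr hx
    ((k0 ey ex).self_of_nhds.trans hxy) rfl
  have Y2 := (hasJet_line ey (le2 (by norm_num) (c1 ey))).congr hy hyy rfl
  have Y3 := (hasJet_line ey (le2 (by norm_num) (c2 ex ex))).congr hxx e211 e2211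
  have Y4 := (hasJet_line ey (le2 (by norm_num) (c2 ex ey))).congr hxy e212 rfl
  have Y5 := (hasJet_line ey (le2 (by norm_num) (c2 ey ey))).congr hyy rfl rfl
  obtain ⟨G1, G11⟩ := (hasJet_logPinch β ha.ne' hb.ne' hab X1 X2 X3 X4 X5).of_isLocalMax hmx
  obtain ⟨G2, G22⟩ := (hasJet_logPinch β ha.ne' hb.ne' hab Y1 Y2 Y3 Y4 Y5).of_isLocalMax hmy
  have E1 := hasJet_exp_logSpeed β ha.ne' hb.ne' X1 X2 X3 X4 X5
  have E2 := hasJet_exp_logSpeed β ha.ne' hb.ne' Y1 Y2 Y3 Y4 Y5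
  -- the time derivatives of `u₁₁` and `u₂₂`, from the equation differentiated twice in space
  have hline : ∀ v : ℝ × ℝ × ℝ, Tendsto (fun s : ℝ => z + s • v) (𝓝 0) (𝓝 z) := by
    intro v
    have : Continuous fun s : ℝ => z + s • v := by fun_prop
    simpa using this.tendsto 0
  have tt : ∀ v, pd et (pd v (pd v u)) z = pd v (pd v (pd et u)) z := by
    intro v
    rw [(k1 et v v).self_of_nhds]
    exact (pd_congr v (k0 et v)).self_of_nhds
  have hT : ∀ v c0 cc1 cc2,
      HasJet (fun s : ℝ => Real.exp (onJet (logSpeed β) u (z + s • v))) 0 c0 cc1 cc2 →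
      pd et (pd v (pd v u)) z = cc2 := by
    intro v c0 cc1 cc2 hj
    have J := (hasJet_line v (le2 (by norm_num) (c1 et))).deriv_deriv
    have he : (fun s : ℝ => pd et u (z + s • v)) =ᶠ[𝓝 0]
        fun s : ℝ => Real.exp (onJet (logSpeed β) u (z + s • v)) := (hline v).eventually hpde
    rw [tt, ← J, he.deriv.deriv_eq, hj.deriv_deriv]
  have P := hT ex _ _ _ E1
  have R := hT ey _ _ _ E2
  -- the time derivative of the pinching quantity
  have T1 := hasJet_line et (le2 (by norm_num) (c1 ex))
  have T2 := hasJet_line et (le2 (by norm_num) (c1 ey))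
  have T3 := hasJet_line et (le2 (by norm_num) (c2 ex ex))
  have T4 := hasJet_line et (le2 (by norm_num) (c2 ex ey))
  have T5 := hasJet_line et (le2 (by norm_num) (c2 ey ey))
  have GT := (hasJet_logPinch β ha.ne' hb.ne' hab (T1.congr hx rfl rfl) (T2.congr hy rfl rfl)
    (T3.congr hxx rfl rfl) (T4.congr hxy rfl rfl) (T5.congr hyy rfl rfl)).hasDerivAt
  refine ⟨_, ?_, GT⟩
  set S := Real.exp (logSpeed β 0 0 a 0 b)
  have hS0 : 0 < S := Real.exp_pos _
  have fin := time_derivative_nonpos ha hb hab h1 h2 G1 G2 G11 G22 rfl rfl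
  rw [P, R]
  have := mul_nonpos_of_nonneg_of_nonpos hS0.le fin
  refine le_of_eq_of_le ?_ this
  ring

end GaussFlow

namespace GaussFlow

open Filter Topology

/-! ### The Weingarten map in terms of the fundamental forms -/

/-- Trace and determinant of a map `W` with `A ∘ W = B`, in terms of the first fundamental form
`⟪A v, A w⟫` and the second fundamental form `⟪B v, A w⟫` on a pair of vectors. -/
lemma trace_det_of_gram {V : Type*} [AddCommGroup V] [Module ℝ V] [FiniteDimensional ℝ V]
    (hV : Module.finrank ℝ V = 2) {A B : V →ₗ[ℝ] E3} {W : V →ₗ[ℝ] V} (hW : ∀ v, A (W v) = B v)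
    {v₁ v₂ : V} {g11 g12 g22 h11 h12 h21 h22 : ℝ}
    (hg11 : inner ℝ (A v₁) (A v₁) = g11) (hg12 : inner ℝ (A v₁) (A v₂) = g12)
    (hg22 : inner ℝ (A v₂) (A v₂) = g22)
    (hh11 : inner ℝ (B v₁) (A v₁) = h11) (hh12 : inner ℝ (B v₁) (A v₂) = h12)
    (hh21 : inner ℝ (B v₂) (A v₁) = h21) (hh22 : inner ℝ (B v₂) (A v₂) = h22)
    (hg : g11 * g22 - g12 ^ 2 ≠ 0) :
    LinearMap.trace ℝ V W * (g11 * g22 - g12 ^ 2) = g11 * h22 + g22 * h11 - g12 * (h12 + h21) ∧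
      LinearMap.det W * (g11 * g22 - g12 ^ 2) = h11 * h22 - h12 * h21 ∧
      W.charpoly = Polynomial.X ^ 2 - Polynomial.C (LinearMap.trace ℝ V W) * Polynomial.X
        + Polynomial.C (LinearMap.det W) := by
  have hg21 : inner ℝ (A v₂) (A v₁) = g12 := by rw [real_inner_comm]; exact hg12
  have hli : LinearIndependent ℝ ![v₁, v₂] := by
    rw [LinearIndependent.pair_iff]
    intro s t hst
    have e : s • A v₁ + t • A v₂ = 0 := by rw [← map_smul, ← map_smul, ← map_add, hst, map_zero]
    have e1 := congrArg (fun w => inner ℝ w (A v₁)) e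
    have e2 := congrArg (fun w => inner ℝ w (A v₂)) e
    simp only [inner_add_left, real_inner_smul_left, inner_zero_left, hg11, hg12, hg21, hg22]
      at e1 e2
    constructor
    · refine (mul_eq_zero.1 ?_).resolve_right hg
      linear_combination g22 * e1 - g12 * e2
    · refine (mul_eq_zero.1 ?_).resolve_right hg
      linear_combination g11 * e2 - g12 * e1
  let b : Module.Basis (Fin 2) ℝ V :=
    basisOfLinearIndependentOfCardEqFinrank hli (by simp [hV])
  have hb : ∀ i, b i = ![v₁, v₂] i := fun i => by simp [b]
  have hb0 : b 0 = v₁ := hb 0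
  have hb1 : b 1 = v₂ := hb 1
  set m := LinearMap.toMatrix b b W with hm
  have hWb : ∀ j, W (b j) = m 0 j • v₁ + m 1 j • v₂ := by
    intro j
    have := b.sum_repr (W (b j))
    rw [Fin.sum_univ_two, hb0, hb1] at this
    rw [← this, hm, LinearMap.toMatrix_apply, LinearMap.toMatrix_apply]
  have hB : ∀ j, B (b j) = m 0 j • A v₁ + m 1 j • A v₂ := by
    intro j
    rw [← hW, hWb, map_add, map_smul, map_smul]
  have hB0 := hB 0
  have hB1 := hB 1
  rw [hb0] at hB0
  rw [hb1] at hB1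
  rw [hB0] at hh11 hh12
  rw [hB1] at hh21 hh22
  simp only [inner_add_left, real_inner_smul_left, hg11, hg12, hg21, hg22] at hh11 hh12 hh21 hh22
  have htr : LinearMap.trace ℝ V W = m 0 0 + m 1 1 := by
    rw [LinearMap.trace_eq_matrix_trace ℝ b, Matrix.trace_fin_two]
  have hdet : LinearMap.det W = m 0 0 * m 1 1 - m 0 1 * m 1 0 := by
    rw [← LinearMap.det_toMatrix b, Matrix.det_fin_two]
  refine ⟨?_, ?_, ?_⟩
  · rw [htr, ← hh11, ← hh12, ← hh21, ← hh22]
    ring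
  · rw [hdet, ← hh11, ← hh12, ← hh21, ← hh22]
    ring
  · rw [← LinearMap.charpoly_toMatrix W b, Matrix.charpoly_fin_two,
      LinearMap.trace_eq_matrix_trace ℝ b, ← LinearMap.det_toMatrix b]

/-- The discriminant of a symmetric form with respect to a positive definite one. -/
lemma discriminant_nonneg {g11 g12 g22 h11 h12 h22 : ℝ} (hg : 0 < g11 * g22 - g12 ^ 2) :
    0 ≤ (g11 * h22 + g22 * h11 - 2 * g12 * h12) ^ 2
      - 4 * (g11 * g22 - g12 ^ 2) * (h11 * h22 - h12 ^ 2) := by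
  have hne : g11 ≠ 0 := by
    rintro rfl
    nlinarith [sq_nonneg g12]
  have key : g11 ^ 2 * ((g11 * h22 + g22 * h11 - 2 * g12 * h12) ^ 2
      - 4 * (g11 * g22 - g12 ^ 2) * (h11 * h22 - h12 ^ 2))
      = (g11 * (g11 * h22 + g22 * h11 - 2 * g12 * h12) - 2 * (g11 * g22 - g12 ^ 2) * h11) ^ 2
        + 4 * (g11 * g22 - g12 ^ 2) * (g11 * h12 - g12 * h11) ^ 2 := by ring
  refine nonneg_of_mul_nonneg_right (a := g11 ^ 2) ?_ (by positivity)
  rw [key]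
  positivity

lemma sort_pair {x y : ℝ} (h : x ≤ y) :
    Multiset.sort ({x, y} : Multiset ℝ) (· ≤ ·) = [x, y] := by
  rw [show ({x, y} : Multiset ℝ) = ((([x, y] : List ℝ)) : Multiset ℝ) from rfl,
    Multiset.coe_sort]
  exact List.mergeSort_of_pairwise (by simpa using h)

variable {M : Type*} [TopologicalSpace M] [ChartedSpace (EuclideanSpace ℝ (Fin 2)) M]

lemma finrank_tangentSpace (x : M) : Module.finrank ℝ (TangentSpace (𝓡 2) x) = 2 := by
  change Module.finrank ℝ (EuclideanSpace ℝ (Fin 2)) = 2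
  simp

/-- The mean curvature. -/
noncomputable def meanCurvature (X : M → E3) (x : M) : ℝ :=
  LinearMap.trace ℝ (TangentSpace (𝓡 2) x) (weingartenMap X x)

/-- The pinching quantity as a function of mean and Gauss curvature. -/
lemma pinching_eq {α : ℝ} {X : M → E3} {x : M}
    (hc : (weingartenMap X x).charpoly = Polynomial.X ^ 2
      - Polynomial.C (meanCurvature X x) * Polynomial.X + Polynomial.C (gaussCurvature X x))
    (hK : 0 < gaussCurvature X x) (hd : 0 ≤ meanCurvature X x ^ 2 - 4 * gaussCurvature X x) :
    pinching α X x = (meanCurvature X x ^ 2 - 4 * gaussCurvature X x)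
      * gaussCurvature X x ^ (α - 2) := by
  set H := meanCurvature X x
  set K := gaussCurvature X x
  set s := Real.sqrt (H ^ 2 - 4 * K) with hs
  have hss : s ^ 2 = H ^ 2 - 4 * K := Real.sq_sqrt hd
  have hs0 : 0 ≤ s := Real.sqrt_nonneg _
  obtain ⟨k₁, hk₁⟩ : ∃ k, k = (H - s) / 2 := ⟨_, rfl⟩
  obtain ⟨k₂, hk₂⟩ : ∃ k, k = (H + s) / 2 := ⟨_, rfl⟩
  have hsum : k₁ + k₂ = H := by rw [hk₁, hk₂]; ring
  have hprod : k₁ * k₂ = K := by rw [hk₁, hk₂]; linear_combination -hss / 4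
  have hle : k₁ ≤ k₂ := by linarith
  have hroots : (weingartenMap X x).charpoly.roots = {k₁, k₂} := by
    rw [hc, ← hsum, ← hprod, show (Polynomial.X ^ 2 - Polynomial.C (k₁ + k₂) * Polynomial.X
      + Polynomial.C (k₁ * k₂) : Polynomial ℝ)
      = (Polynomial.X - Polynomial.C k₁) * (Polynomial.X - Polynomial.C k₂) by
        rw [Polynomial.C_add, Polynomial.C_mul]; ring]
    rw [Polynomial.roots_mul (mul_ne_zero (Polynomial.X_sub_C_ne_zero _)
      (Polynomial.X_sub_C_ne_zero _)), Polynomial.roots_X_sub_C, Polynomial.roots_X_sub_C]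
    rfl
  have hpc : principalCurvatures X x = [k₁, k₂] := by
    rw [principalCurvatures, hroots, sort_pair hle]
  have hr1 : r₁ X x = k₂⁻¹ := by simp [r₁, hpc]
  have hr2 : r₂ X x = k₁⁻¹ := by simp [r₂, hpc]
  have hk1 : k₁ ≠ 0 := by rintro h; rw [h, zero_mul] at hprod; exact hK.ne hprod
  have hk2 : k₂ ≠ 0 := by rintro h; rw [h, mul_zero] at hprod; exact hK.ne hprod
  rw [pinching, hr1, hr2, show k₂⁻¹ * k₁⁻¹ = K⁻¹ by rw [← hprod, mul_inv, mul_comm],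
    Real.inv_rpow hK.le, Real.rpow_sub hK, Real.rpow_two, ← hss]
  have hKs : s = k₂ - k₁ := by rw [hk₁, hk₂]; ring
  have : 0 < K ^ α := Real.rpow_pos_of_pos hK _
  rw [← hprod] at this
  rw [hKs, ← hprod]
  field_simp
  ring

end GaussFlow

namespace GaussFlow

open Filter Topology

/-! ### Differentials in a chart -/

variable {M : Type*} [TopologicalSpace M] [ChartedSpace (EuclideanSpace ℝ (Fin 2)) M]

section Charts

variable {F : Type*} [NormedAddCommGroup F] [NormedSpace ℝ F]

lemma mvfderiv_comp_apply' {g : E3 → F} {X : M → E3} {x : M} (hg : DifferentiableAt ℝ g (X x))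
    (hX : MDifferentiableAt (𝓡 2) 𝓘(ℝ, E3) X x) (v : TangentSpace (𝓡 2) x) :
    mvfderiv (𝓡 2) (fun y => g (X y)) x v = fderiv ℝ g (X x) (diff X x v) := by
  have h := (hg.hasFDerivAt.hasMFDerivAt.comp x hX.hasMFDerivAt).mfderiv
  change mfderiv (𝓡 2) 𝓘(ℝ, F) (g ∘ X) x v = _
  rw [h]
  rfl

lemma mvfderiv_congr {f g : M → F} {x : M} (h : f =ᶠ[𝓝 x] g) (v : TangentSpace (𝓡 2) x) :
    mvfderiv (𝓡 2) f x v = mvfderiv (𝓡 2) g x v := by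
  change mfderiv (𝓡 2) 𝓘(ℝ, F) f x v = mfderiv (𝓡 2) 𝓘(ℝ, F) g x v
  rw [h.mfderiv_eq]
  rfl

variable [IsManifold (𝓡 2) ∞ M]

/-- A chart identifies the tangent space with the plane, compatibly with differentials. -/
lemma exists_chart_frame (x₀ x : M) (hx : x ∈ (extChartAt (𝓡 2) x₀).source) :
    ∃ L : EuclideanSpace ℝ (Fin 2) →L[ℝ] TangentSpace (𝓡 2) x, Function.Bijective L ∧
      ∀ f : M → E3, MDifferentiableAt (𝓡 2) 𝓘(ℝ, E3) f x →
        HasFDerivAt (f ∘ (extChartAt (𝓡 2) x₀).symm) ((diff f x).comp L)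
          (extChartAt (𝓡 2) x₀ x) := by
  obtain ⟨y, hy, rfl⟩ : ∃ y ∈ (extChartAt (𝓡 2) x₀).target, x = (extChartAt (𝓡 2) x₀).symm y :=
    ⟨_, (extChartAt (𝓡 2) x₀).map_source hx, ((extChartAt (𝓡 2) x₀).left_inv hx).symm⟩
  have hinv := isInvertible_mfderivWithin_extChartAt_symm (I := 𝓡 2) hy
  have hd := mdifferentiableWithinAt_extChartAt_symm (I := 𝓡 2) hy
  rw [ModelWithCorners.range_eq_univ, mdifferentiableWithinAt_univ] at hd
  rw [ModelWithCorners.range_eq_univ, mfderivWithin_univ] at hinv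
  refine ⟨mfderiv 𝓘(ℝ, EuclideanSpace ℝ (Fin 2)) (𝓡 2) (extChartAt (𝓡 2) x₀).symm y,
    hinv.bijective, fun f hf => ?_⟩
  rw [(extChartAt (𝓡 2) x₀).right_inv hy]
  exact (hf.hasMFDerivAt.comp y hd.hasMFDerivAt).hasFDerivAt

lemma mdifferentiableAt_of_chart {f : M → E3} {x₀ x : M}
    (hx : x ∈ (extChartAt (𝓡 2) x₀).source)
    (h : DifferentiableAt ℝ (f ∘ (extChartAt (𝓡 2) x₀).symm) (extChartAt (𝓡 2) x₀ x)) :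
    MDifferentiableAt (𝓡 2) 𝓘(ℝ, E3) f x := by
  have h1 := (mdifferentiableAt_iff_differentiableAt.2 h).comp x
    (mdifferentiableAt_extChartAt (I := 𝓡 2) (by rwa [← extChartAt_source (I := 𝓡 2)]))
  refine h1.congr_of_eventuallyEq ?_
  filter_upwards [extChartAt_source_mem_nhds' (I := 𝓡 2) hx] with z hz
  simp only [Function.comp_apply, (extChartAt (𝓡 2) x₀).left_inv hz]

end Charts

/-! ### The outer unit normal -/

lemma orthogonal_range_eq_span {V : Type*} [AddCommGroup V] [Module ℝ V] [FiniteDimensional ℝ V]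
    (hV : Module.finrank ℝ V = 2) {A : V →ₗ[ℝ] E3} (hA : Function.Injective A) {n : E3}
    (hn : ‖n‖ = 1) (hAn : ∀ v, inner ℝ (A v) n = 0) : (LinearMap.range A)ᗮ = ℝ ∙ n := by
  have h1 : Module.finrank ℝ (LinearMap.range A)ᗮ = 1 := by
    have h2 := (LinearMap.range A).finrank_add_finrank_orthogonal
    rw [LinearMap.finrank_range_of_inj hA, hV] at h2
    simp at h2
    omega
  have hne : n ≠ 0 := by rintro rfl; simp at hn
  symm
  apply Submodule.eq_of_le_of_finrank_eq
  · rw [Submodule.span_singleton_le_iff_mem, Submodule.mem_orthogonal]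
    rintro _ ⟨v, rfl⟩
    exact hAn v
  · rw [h1, finrank_span_singleton hne]

lemma eq_or_eq_neg_of_unit_normal {V : Type*} [AddCommGroup V] [Module ℝ V]
    [FiniteDimensional ℝ V] (hV : Module.finrank ℝ V = 2) {A : V →ₗ[ℝ] E3}
    (hA : Function.Injective A) {n m : E3} (hn : ‖n‖ = 1) (hAn : ∀ v, inner ℝ (A v) n = 0)
    (hm : ‖m‖ = 1) (hAm : ∀ v, inner ℝ (A v) m = 0) : m = n ∨ m = -n := by
  have h : m ∈ ℝ ∙ n := by
    rw [← orthogonal_range_eq_span hV hA hn hAn, orthogonal_range_eq_span hV hA hm hAm]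
    exact Submodule.mem_span_singleton_self m
  obtain ⟨c, rfl⟩ := Submodule.mem_span_singleton.1 h
  rw [norm_smul, hn, mul_one, Real.norm_eq_abs] at hm
  rcases eq_or_eq_neg_of_abs_eq hm with rfl | rfl <;> simp

lemma mem_range_of_inner_eq_zero {V : Type*} [AddCommGroup V] [Module ℝ V]
    [FiniteDimensional ℝ V] (hV : Module.finrank ℝ V = 2) {A : V →ₗ[ℝ] E3}
    (hA : Function.Injective A) {n w : E3} (hn : ‖n‖ = 1) (hAn : ∀ v, inner ℝ (A v) n = 0)
    (hw : inner ℝ w n = 0) : ∃ v, A v = w := by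
  have h := orthogonal_range_eq_span hV hA hn hAn
  have h2 : LinearMap.range A = (ℝ ∙ n)ᗮ := by
    rw [← h, Submodule.orthogonal_orthogonal]
  have : w ∈ (ℝ ∙ n)ᗮ := by
    rw [Submodule.mem_orthogonal_singleton_iff_inner_left]
    exact hw
  rw [← h2] at this
  exact this

/-- The maximum of a nonzero linear functional on a compact set is attained on its frontier. -/
lemma exists_frontier_isMaxOn_inner {C : Set E3} (hC : IsCompact C) (hne : C.Nonempty) {n : E3}
    (hn : n ≠ 0) : ∃ c ∈ frontier C, ∀ a ∈ C, inner ℝ a n ≤ inner ℝ c n := by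
  obtain ⟨c, hc, hmax⟩ := hC.exists_isMaxOn hne
    (f := fun a => inner ℝ a n) (by fun_prop)
  refine ⟨c, ⟨subset_closure hc, fun hint => ?_⟩, fun a ha => hmax ha⟩
  have hcont : Tendsto (fun s : ℝ => c + s • n) (𝓝[>] 0) (𝓝 c) := by
    have : Continuous fun s : ℝ => c + s • n := by fun_prop
    have := this.tendsto 0
    simp only [zero_smul, add_zero] at this
    exact this.mono_left nhdsWithin_le_nhds
  have hev : ∀ᶠ s : ℝ in 𝓝[>] 0, c + s • n ∈ C :=
    hcont.eventually (mem_interior_iff_mem_nhds.1 hint)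
  obtain ⟨s, hs, hs0⟩ := (hev.and self_mem_nhdsWithin).exists
  have h1 : inner ℝ (c + s • n) n ≤ inner ℝ c n := hmax hs
  rw [inner_add_left, real_inner_smul_left, real_inner_self_eq_norm_sq] at h1
  have : 0 < s * ‖n‖ ^ 2 := mul_pos hs0 (by positivity)
  linarith

variable {X : M → E3} {x : M} {n : E3}

/-- A convex surface does not lie in one of its tangent planes. -/
lemma IsStrictlyConvexEmbedding.exists_inner_neg (hX : IsStrictlyConvexEmbedding X) (hn : n ≠ 0)
    (hout : ∀ y, inner ℝ (X y - X x) n ≤ 0) : ∃ z, inner ℝ (X z - X x) n < 0 := by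
  obtain ⟨C, -, hC, ⟨i, hi⟩, hr⟩ := hX.convex
  by_contra! hcon
  have hne : C.Nonempty := ⟨i, interior_subset hi⟩
  obtain ⟨c, hc, hcmax⟩ := exists_frontier_isMaxOn_inner hC hne hn
  obtain ⟨d, hd, hdmin⟩ := exists_frontier_isMaxOn_inner hC hne (neg_ne_zero.2 hn)
  rw [← hr] at hc hd
  obtain ⟨y, rfl⟩ := hc
  obtain ⟨z, rfl⟩ := hd
  have h1 := hout y
  have h2 := hcon z
  rw [inner_sub_left] at h1 h2
  -- the functional is constant on `C`, although `C` has interior points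
  have hconst : ∀ a ∈ C, inner ℝ a n = inner ℝ (X x) n := fun a ha => by
    have h3 := hcmax a ha
    have h4 := hdmin a ha
    rw [inner_neg_right, inner_neg_right] at h4
    linarith
  have hloc : (fun a : E3 => inner ℝ a n) =ᶠ[𝓝 i] fun _ => inner ℝ (X x) n := by
    filter_upwards [mem_interior_iff_mem_nhds.1 hi] with a ha using hconst a ha
  have hcont : Tendsto (fun s : ℝ => i + s • n) (𝓝[>] 0) (𝓝 i) := by
    have : Continuous fun s : ℝ => i + s • n := by fun_prop
    have := this.tendsto 0
    simp only [zero_smul, add_zero] at this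
    exact this.mono_left nhdsWithin_le_nhds
  obtain ⟨s, hs, hs0⟩ := ((hcont.eventually hloc).and self_mem_nhdsWithin).exists
  have h5 := hloc.self_of_nhds
  simp only [inner_add_left, real_inner_smul_left, real_inner_self_eq_norm_sq] at hs h5
  have : 0 < s * ‖n‖ ^ 2 := mul_pos hs0 (by positivity)
  linarith

variable [IsManifold (𝓡 2) ∞ M]

lemma IsStrictlyConvexEmbedding.exists_isOuterUnitNormal (hX : IsStrictlyConvexEmbedding X)
    (hd : MDifferentiable (𝓡 2) 𝓘(ℝ, E3) X) (x : M) : ∃ n, IsOuterUnitNormal X x n := by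
  obtain ⟨C, hconv, hC, hint, hr⟩ := hX.convex
  have hx : X x ∈ frontier C := by rw [← hr]; exact mem_range_self x
  obtain ⟨f, hf⟩ := geometric_hahn_banach_open_point hconv.interior isOpen_interior hx.2
  have hle : ∀ a ∈ C, f a ≤ f (X x) := by
    intro a ha
    have hcl : a ∈ closure (interior C) := by
      rw [hconv.closure_interior_eq_closure_of_nonempty_interior hint]
      exact subset_closure ha
    exact closure_minimal (fun b hb => (hf b hb).le) (isClosed_le f.continuous continuous_const) hcl
  set m := (InnerProductSpace.toDual ℝ E3).symm f with hm
  have hfm : ∀ a, f a = inner ℝ a m := fun a => by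
    rw [hm, real_inner_comm, InnerProductSpace.toDual_symm_apply]
  have hm0 : m ≠ 0 := by
    intro h0
    obtain ⟨i, hi⟩ := hint
    have := hf i hi
    rw [hfm, hfm, h0, inner_zero_right, inner_zero_right] at this
    exact lt_irrefl _ this
  have hout : ∀ y, inner ℝ (X y - X x) m ≤ 0 := by
    intro y
    have hy : X y ∈ C := hC.isClosed.frontier_subset (by rw [← hr]; exact mem_range_self y)
    have := hle _ hy
    rw [hfm, hfm] at this
    rw [inner_sub_left]
    linarith
  have horth : ∀ v : TangentSpace (𝓡 2) x, inner ℝ (diff X x v) m = 0 := by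
    obtain ⟨L, hL, hLd⟩ := exists_chart_frame x x (mem_extChartAt_source x)
    intro v
    obtain ⟨w, rfl⟩ := hL.2 v
    have h1 := hLd X (hd x)
    have h2 := h1.inner ℝ (hasFDerivAt_const m (extChartAt (𝓡 2) x x))
    have hmax : IsLocalMax (fun y => inner ℝ ((X ∘ (extChartAt (𝓡 2) x).symm) y) m)
        (extChartAt (𝓡 2) x x) := by
      refine .of_forall fun y => ?_
      have := hout ((extChartAt (𝓡 2) x).symm y)
      rw [inner_sub_left] at this
      simp only [Function.comp_apply, extChartAt_to_inv]
      linarith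
    have h3 := DFunLike.congr_fun (hmax.hasFDerivAt_eq_zero h2) w
    simpa using h3
  refine ⟨‖m‖⁻¹ • m, ?_, fun v => ?_, fun y => ?_⟩
  · rw [norm_smul, norm_inv, norm_norm, inv_mul_cancel₀ (norm_ne_zero_iff.2 hm0)]
  · rw [inner_smul_right, horth, mul_zero]
  · rw [inner_smul_right]
    exact mul_nonpos_of_nonneg_of_nonpos (by positivity) (hout y)

lemma IsStrictlyConvexEmbedding.outerUnitNormal_spec (hX : IsStrictlyConvexEmbedding X)
    (hd : MDifferentiable (𝓡 2) 𝓘(ℝ, E3) X) (x : M) :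
    IsOuterUnitNormal X x (outerUnitNormal X x) :=
  Classical.epsilon_spec (hX.exists_isOuterUnitNormal hd x)

/-- A unit vector orthogonal to the tangent plane is the outer normal as soon as one point of the
surface lies strictly on its inner side. -/
lemma IsStrictlyConvexEmbedding.outerUnitNormal_eq (hX : IsStrictlyConvexEmbedding X)
    (hd : MDifferentiable (𝓡 2) 𝓘(ℝ, E3) X) (hn : ‖n‖ = 1)
    (horth : ∀ v : TangentSpace (𝓡 2) x, inner ℝ (diff X x v) n = 0)
    (hz : ∃ z, inner ℝ (X z - X x) n < 0) : outerUnitNormal X x = n := by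
  have hν := hX.outerUnitNormal_spec hd x
  rcases eq_or_eq_neg_of_unit_normal (finrank_tangentSpace x)
    (A := (diff X x : TangentSpace (𝓡 2) x →ₗ[ℝ] E3)) (hX.immersion x) hn horth
    hν.norm_eq_one hν.orthogonal with h | h
  · exact h
  · obtain ⟨z, hz⟩ := hz
    have := hν.outward z
    rw [h, inner_neg_right] at this
    linarith

end GaussFlow

namespace GaussFlow

open Filter Topology

/-! ### Curvatures in terms of a frame -/

variable {M : Type*} [TopologicalSpace M] [ChartedSpace (EuclideanSpace ℝ (Fin 2)) M]

section Frame

variable {X : M → E3} {x : M} [IsManifold (𝓡 2) ∞ M]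

lemma inner_diff_outerUnitNormal_self (hX : IsStrictlyConvexEmbedding X)
    (hd : MDifferentiable (𝓡 2) 𝓘(ℝ, E3) X)
    (hν : MDifferentiableAt (𝓡 2) 𝓘(ℝ, E3) (outerUnitNormal X) x) (v : TangentSpace (𝓡 2) x) :
    inner ℝ (diff (outerUnitNormal X) x v) (outerUnitNormal X x) = 0 := by
  have h1 := mvfderiv_comp_apply' (X := outerUnitNormal X) (x := x)
    (g := fun w : E3 => inner ℝ w w) (differentiableAt_id.inner ℝ differentiableAt_id) hν v
  have h2 : (fun y => inner ℝ (outerUnitNormal X y) (outerUnitNormal X y)) =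
      fun _ : M => (1 : ℝ) := by
    funext y
    rw [real_inner_self_eq_norm_sq, (hX.outerUnitNormal_spec hd y).norm_eq_one, one_pow]
  rw [h2, mvfderiv_const] at h1
  have h3 : HasFDerivAt (fun w : E3 => inner ℝ w w) _ (outerUnitNormal X x) :=
    (hasFDerivAt_id (outerUnitNormal X x)).inner ℝ (hasFDerivAt_id (outerUnitNormal X x))
  rw [h3.fderiv] at h1
  simp [real_inner_comm] at h1
  rw [real_inner_comm]
  linarith

lemma diff_weingartenMap (hX : IsStrictlyConvexEmbedding X)
    (hd : MDifferentiable (𝓡 2) 𝓘(ℝ, E3) X)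
    (hν : MDifferentiableAt (𝓡 2) 𝓘(ℝ, E3) (outerUnitNormal X) x) (v : TangentSpace (𝓡 2) x) :
    diff X x (weingartenMap X x v) = diff (outerUnitNormal X) x v := by
  have hs := hX.outerUnitNormal_spec hd x
  let A : TangentSpace (𝓡 2) x →ₗ[ℝ] E3 := diff X x
  let B : TangentSpace (𝓡 2) x →ₗ[ℝ] E3 := diff (outerUnitNormal X) x
  have hA : Function.Injective A := hX.immersion x
  have hmem : ∀ v, B v ∈ LinearMap.range A := fun v =>
    mem_range_of_inner_eq_zero (finrank_tangentSpace x) hA hs.norm_eq_one hs.orthogonal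
      (inner_diff_outerUnitNormal_self hX hd hν v)
  have hex : ∃ W : TangentSpace (𝓡 2) x →ₗ[ℝ] TangentSpace (𝓡 2) x,
      ∀ v, diff X x (W v) = diff (outerUnitNormal X) x v := by
    refine ⟨(LinearEquiv.ofInjective A hA).symm.toLinearMap ∘ₗ
      B.codRestrict (LinearMap.range A) hmem, fun v => ?_⟩
    have := LinearEquiv.ofInjective_symm_apply (f := A) (h := hA) ⟨B v, hmem v⟩
    exact this
  exact Classical.epsilon_spec (p := fun W : TangentSpace (𝓡 2) x →ₗ[ℝ] TangentSpace (𝓡 2) x =>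
    ∀ v, diff X x (W v) = diff (outerUnitNormal X) x v) hex v

/-- The curvatures of a strictly convex surface in terms of the matrices of the first and second
fundamental forms. -/
theorem curvatures_of_frame (hX : IsStrictlyConvexEmbedding X)
    (hd : MDifferentiable (𝓡 2) 𝓘(ℝ, E3) X)
    (hν : MDifferentiableAt (𝓡 2) 𝓘(ℝ, E3) (outerUnitNormal X) x) {v₁ v₂ : TangentSpace (𝓡 2) x}
    {g11 g12 g22 h11 h12 h22 : ℝ}
    (hg11 : inner ℝ (diff X x v₁) (diff X x v₁) = g11)
    (hg12 : inner ℝ (diff X x v₁) (diff X x v₂) = g12)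
    (hg22 : inner ℝ (diff X x v₂) (diff X x v₂) = g22)
    (hh11 : inner ℝ (diff (outerUnitNormal X) x v₁) (diff X x v₁) = h11)
    (hh12 : inner ℝ (diff (outerUnitNormal X) x v₁) (diff X x v₂) = h12)
    (hh21 : inner ℝ (diff (outerUnitNormal X) x v₂) (diff X x v₁) = h12)
    (hh22 : inner ℝ (diff (outerUnitNormal X) x v₂) (diff X x v₂) = h22)
    (hg : 0 < g11 * g22 - g12 ^ 2) :
    meanCurvature X x * (g11 * g22 - g12 ^ 2) = g11 * h22 + g22 * h11 - 2 * g12 * h12 ∧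
      gaussCurvature X x * (g11 * g22 - g12 ^ 2) = h11 * h22 - h12 ^ 2 ∧
      0 < gaussCurvature X x ∧ 0 ≤ meanCurvature X x ^ 2 - 4 * gaussCurvature X x ∧
      (weingartenMap X x).charpoly = Polynomial.X ^ 2
        - Polynomial.C (meanCurvature X x) * Polynomial.X
        + Polynomial.C (gaussCurvature X x) := by
  obtain ⟨htr, hdet, hchar⟩ := trace_det_of_gram (finrank_tangentSpace x)
    (A := (diff X x : TangentSpace (𝓡 2) x →ₗ[ℝ] E3))
    (B := (diff (outerUnitNormal X) x : TangentSpace (𝓡 2) x →ₗ[ℝ] E3))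
    (diff_weingartenMap hX hd hν) hg11 hg12 hg22 hh11 hh12 hh21 hh22 hg.ne'
  have htr' : meanCurvature X x * (g11 * g22 - g12 ^ 2)
      = g11 * h22 + g22 * h11 - 2 * g12 * h12 := htr.trans (by ring)
  have hdet' : gaussCurvature X x * (g11 * g22 - g12 ^ 2) = h11 * h22 - h12 ^ 2 :=
    hdet.trans (by ring)
  -- positivity of the second fundamental form at `v₂` and at `h22 v₁ - h12 v₂`
  have hne : ∀ a b : ℝ, a • v₁ + b • v₂ = 0 → a = 0 ∧ b = 0 := by
    intro a b hab
    have e : a • diff X x v₁ + b • diff X x v₂ = 0 := by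
      rw [← map_smul, ← map_smul, ← map_add, hab, map_zero]
    have e1 := congrArg (fun w => inner ℝ w (diff X x v₁)) e
    have e2 := congrArg (fun w => inner ℝ w (diff X x v₂)) e
    simp only [inner_add_left, real_inner_smul_left, inner_zero_left, hg11, hg12, hg22,
      real_inner_comm (diff X x v₁) (diff X x v₂)] at e1 e2
    constructor
    · refine (mul_eq_zero.1 ?_).resolve_right hg.ne'
      linear_combination g22 * e1 - g12 * e2
    · refine (mul_eq_zero.1 ?_).resolve_right hg.ne'
      linear_combination g11 * e2 - g12 * e1
  have hq : ∀ a b : ℝ, (a ≠ 0 ∨ b ≠ 0) → 0 < a ^ 2 * h11 + 2 * a * b * h12 + b ^ 2 * h22 := by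
    intro a b hab
    have h0 : a • v₁ + b • v₂ ≠ 0 := fun h => by
      obtain ⟨ha, hb⟩ := hne a b h
      rcases hab with h | h
      · exact h ha
      · exact h hb
    have hp := hX.posDef x _ h0
    rw [secondFundamentalForm] at hp
    simp only [map_add, map_smul, inner_add_left, inner_add_right, real_inner_smul_left,
      real_inner_smul_right, hh11, hh12, hh21, hh22] at hp
    linarith
  have h22pos : 0 < h22 := by simpa using hq 0 1 (.inr one_ne_zero)
  have hdpos : 0 < h11 * h22 - h12 ^ 2 := by
    have h := hq h22 (-h12) (.inl h22pos.ne')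
    have : 0 < h22 * (h11 * h22 - h12 ^ 2) := by linarith
    exact pos_of_mul_pos_right this h22pos.le
  refine ⟨htr', hdet', ?_, ?_, hchar⟩
  · rw [← hdet'] at hdpos
    exact pos_of_mul_pos_left hdpos hg.le
  · have hdisc := discriminant_nonneg (h11 := h11) (h12 := h12) (h22 := h22) hg
    rw [← htr', ← hdet'] at hdisc
    have : 0 ≤ (g11 * g22 - g12 ^ 2) ^ 2 *
        (meanCurvature X x ^ 2 - 4 * gaussCurvature X x) := by linarith
    exact nonneg_of_mul_nonneg_right this (by positivity)

end Frame

lemma gram_det_pos {a b : E3} (h : ∀ s t : ℝ, s • a + t • b = 0 → s = 0 ∧ t = 0) :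
    0 < inner ℝ a a * inner ℝ b b - inner ℝ a b ^ 2 := by
  have hb : b ≠ 0 := fun hb => one_ne_zero (h 0 1 (by simp [hb])).2
  have hb0 : 0 < inner ℝ b b := real_inner_self_pos.2 hb
  have hne : inner ℝ b b • a + (-inner ℝ a b) • b ≠ 0 := fun h0 => hb0.ne' (h _ _ h0).1
  have h1 := real_inner_self_pos.2 hne
  simp only [inner_add_left, inner_add_right, real_inner_smul_left, real_inner_smul_right,
    real_inner_comm a b] at h1
  have : 0 < inner ℝ b b * (inner ℝ a a * inner ℝ b b - inner ℝ a b ^ 2) := by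
    refine h1.trans_eq ?_
    ring
  exact pos_of_mul_pos_right this hb0.le

end GaussFlow

namespace GaussFlow

open Filter Topology

/-! ### Space derivatives of maps depending on time -/

section Slices

variable {E F : Type*} [NormedAddCommGroup E] [NormedSpace ℝ E] [NormedAddCommGroup F]
  [NormedSpace ℝ F] {U : Set E} {J : Set ℝ} {Y : E × ℝ → F}

/-- The derivative of `Y` in the space direction `v`, taken within `S` so that it makes sense at the
initial time. -/
noncomputable def spat (S : Set (E × ℝ)) (v : E) (Y : E × ℝ → F) (p : E × ℝ) : F :=
  fderivWithin ℝ Y S p (v, 0)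

lemma hasFDerivAt_slice (hU : IsOpen U) (hY : DifferentiableOn ℝ Y (U ×ˢ J)) {y : E} (hy : y ∈ U)
    {t : ℝ} (ht : t ∈ J) :
    HasFDerivAt (fun z => Y (z, t))
      ((fderivWithin ℝ Y (U ×ˢ J) (y, t)).comp (ContinuousLinearMap.inl ℝ E ℝ)) y := by
  have h1 := (hY (y, t) ⟨hy, ht⟩).hasFDerivWithinAt
  have h2 : HasFDerivAt (fun z : E => (z, t)) (ContinuousLinearMap.inl ℝ E ℝ) y :=
    hasFDerivAt_prodMk_left y t
  have h3 := h1.comp y (t := U ×ˢ J) (h2.hasFDerivWithinAt (s := U))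
    (fun z hz => mk_mem_prod hz ht)
  exact h3.hasFDerivAt (hU.mem_nhds hy)

lemma contDiffOn_spat (hU : IsOpen U) (hJ : UniqueDiffOn ℝ J) (hY : ContDiffOn ℝ ∞ Y (U ×ˢ J))
    (v : E) : ContDiffOn ℝ ∞ (spat (U ×ˢ J) v Y) (U ×ˢ J) :=
  (hY.fderivWithin (hU.uniqueDiffOn.prod hJ) (by simp)).clm_apply contDiffOn_const

lemma pd_slice (hU : IsOpen U) (hY : DifferentiableOn ℝ Y (U ×ˢ J)) {y : E} (hy : y ∈ U)
    {t : ℝ} (ht : t ∈ J) (v : E) : pd v (fun z => Y (z, t)) y = spat (U ×ˢ J) v Y (y, t) := by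
  rw [pd, (hasFDerivAt_slice hU hY hy ht).fderiv]
  rfl

lemma contDiffAt_slice (hU : IsOpen U) (hY : ContDiffOn ℝ ∞ Y (U ×ˢ J)) {y : E} (hy : y ∈ U)
    {t : ℝ} (ht : t ∈ J) : ContDiffAt ℝ ∞ (fun z => Y (z, t)) y := by
  have h : ContDiffOn ℝ ∞ (fun z => Y (z, t)) U :=
    hY.comp (t := U ×ˢ J) (f := fun z : E => (z, t)) (by fun_prop) (fun z hz => ⟨hz, ht⟩)
  exact h.contDiffAt (hU.mem_nhds hy)

lemma spat_spat_comm (hU : IsOpen U) (hJ : UniqueDiffOn ℝ J) (hY : ContDiffOn ℝ ∞ Y (U ×ˢ J))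
    {y : E} (hy : y ∈ U) {t : ℝ} (ht : t ∈ J) (v w : E) :
    spat (U ×ˢ J) v (spat (U ×ˢ J) w Y) (y, t) = spat (U ×ˢ J) w (spat (U ×ˢ J) v Y) (y, t) := by
  have key : ∀ v w : E, spat (U ×ˢ J) v (spat (U ×ˢ J) w Y) (y, t)
      = pd v (pd w (fun z => Y (z, t))) y := by
    intro v w
    rw [← pd_slice hU ((contDiffOn_spat hU hJ hY w).differentiableOn (by simp)) hy ht]
    refine (pd_congr v ?_).self_of_nhds
    filter_upwards [hU.mem_nhds hy] with z hz
    rw [pd_slice hU (hY.differentiableOn (by simp)) hz ht]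
  rw [key, key]
  exact pd_comm v w ((contDiffAt_slice hU hY hy ht).of_le ENat.LEInfty.out)

omit [NormedSpace ℝ E] in
lemma tendsto_slice (hU : IsOpen U) {y : E} (hy : y ∈ U) {t : ℝ} (ht : t ∈ J) :
    Tendsto (fun z : E => (z, t)) (𝓝 y) (𝓝[U ×ˢ J] (y, t)) := by
  refine tendsto_nhdsWithin_iff.2 ⟨?_, ?_⟩
  · have : Continuous fun z : E => (z, t) := by fun_prop
    exact this.tendsto y
  · filter_upwards [hU.mem_nhds hy] with z hz using ⟨hz, ht⟩

end Slices

/-! ### The flow in a chart -/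

variable {M : Type*} [TopologicalSpace M] [ChartedSpace (EuclideanSpace ℝ (Fin 2)) M]
  [IsManifold (𝓡 2) ∞ M] {α T : ℝ} {X : ℝ → M → E3}

omit [IsManifold (𝓡 2) ∞ M] in
lemma IsSolution.mdifferentiable (hX : IsSolution α T X) {t : ℝ} (ht : t ∈ Ico 0 T) :
    MDifferentiable (𝓡 2) 𝓘(ℝ, E3) (X t) := by
  have h : ContMDiff (𝓡 2) ((𝓡 2).prod 𝓘(ℝ, ℝ)) ∞ (fun x : M => (x, t)) :=
    contMDiff_id.prodMk contMDiff_const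
  have h2 : ContMDiff (𝓡 2) 𝓘(ℝ, E3) ∞ (X t) :=
    hX.smooth.comp_contMDiff h (fun x => ⟨mem_univ _, ht⟩)
  exact h2.mdifferentiable (by simp)

/-- The flow, read in the chart at `x₀`. -/
noncomputable def inChart (X : ℝ → M → E3) (x₀ : M) (p : EuclideanSpace ℝ (Fin 2) × ℝ) : E3 :=
  X p.2 ((extChartAt (𝓡 2) x₀).symm p.1)

/-- The outer unit normal along the flow, read in the chart at `x₀`. -/
noncomputable def normalInChart (X : ℝ → M → E3) (x₀ : M) (p : EuclideanSpace ℝ (Fin 2) × ℝ) :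
    E3 :=
  outerUnitNormal (X p.2) ((extChartAt (𝓡 2) x₀).symm p.1)

lemma IsSolution.contDiffOn_inChart (hX : IsSolution α T X) (x₀ : M) :
    ContDiffOn ℝ ∞ (inChart X x₀) ((extChartAt (𝓡 2) x₀).target ×ˢ Ico 0 T) := by
  rw [← contMDiffOn_iff_contDiffOn]
  have h1 : ContMDiffOn 𝓘(ℝ, EuclideanSpace ℝ (Fin 2) × ℝ) (𝓡 2) ∞
      (fun p : EuclideanSpace ℝ (Fin 2) × ℝ => (extChartAt (𝓡 2) x₀).symm p.1)
      ((extChartAt (𝓡 2) x₀).target ×ˢ Ico 0 T) :=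
    (contMDiffOn_extChartAt_symm x₀).comp contDiff_fst.contMDiff.contMDiffOn (fun p hp => hp.1)
  have h2 : ContMDiffOn 𝓘(ℝ, EuclideanSpace ℝ (Fin 2) × ℝ) 𝓘(ℝ, ℝ) ∞
      (fun p : EuclideanSpace ℝ (Fin 2) × ℝ => p.2)
      ((extChartAt (𝓡 2) x₀).target ×ˢ Ico 0 T) := contDiff_snd.contMDiff.contMDiffOn
  exact hX.smooth.comp (h1.prodMk h2) (fun p hp => ⟨mem_univ _, hp.2⟩)

/-- The first coordinate direction of the plane. -/
noncomputable def b₁ : EuclideanSpace ℝ (Fin 2) := EuclideanSpace.basisFun (Fin 2) ℝ 0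

/-- The second coordinate direction of the plane. -/
noncomputable def b₂ : EuclideanSpace ℝ (Fin 2) := EuclideanSpace.basisFun (Fin 2) ℝ 1

lemma eq_smul_add_smul (w : EuclideanSpace ℝ (Fin 2)) : w = w 0 • b₁ + w 1 • b₂ := by
  have := (EuclideanSpace.basisFun (Fin 2) ℝ).sum_repr w
  rw [Fin.sum_univ_two] at this
  exact this.symm

lemma smul_add_smul_eq_zero {s t : ℝ} (h : s • b₁ + t • b₂ = 0) : s = 0 ∧ t = 0 := by
  have h0 := congrArg (fun w : EuclideanSpace ℝ (Fin 2) => w 0) h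
  have h1 := congrArg (fun w : EuclideanSpace ℝ (Fin 2) => w 1) h
  simp [b₁, b₂] at h0 h1
  exact ⟨h0, h1⟩

section ChartPoint

variable {x₀ : M} {y : EuclideanSpace ℝ (Fin 2)} {t : ℝ}

/-- The chart induces a frame in which `dX` is given by the space derivatives of the flow in the
chart. -/
lemma IsSolution.exists_frame (hX : IsSolution α T X) (hy : y ∈ (extChartAt (𝓡 2) x₀).target)
    (ht : t ∈ Ico 0 T) :
    ∃ L : EuclideanSpace ℝ (Fin 2) →L[ℝ] TangentSpace (𝓡 2) ((extChartAt (𝓡 2) x₀).symm y),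
      Function.Bijective L ∧
      (∀ w, diff (X t) ((extChartAt (𝓡 2) x₀).symm y) (L w)
        = spat ((extChartAt (𝓡 2) x₀).target ×ˢ Ico 0 T) w (inChart X x₀) (y, t)) ∧
      ∀ f : M → E3, MDifferentiableAt (𝓡 2) 𝓘(ℝ, E3) f ((extChartAt (𝓡 2) x₀).symm y) →
        HasFDerivAt (f ∘ (extChartAt (𝓡 2) x₀).symm)
          ((diff f ((extChartAt (𝓡 2) x₀).symm y)).comp L) y := by
  obtain ⟨L, hL, hLd⟩ := exists_chart_frame x₀ _ ((extChartAt (𝓡 2) x₀).map_target hy)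
  rw [(extChartAt (𝓡 2) x₀).right_inv hy] at hLd
  refine ⟨L, hL, fun w => ?_, hLd⟩
  have h1 := hLd (X t) (hX.mdifferentiable ht _)
  have h2 := hasFDerivAt_slice (isOpen_extChartAt_target x₀)
    ((hX.contDiffOn_inChart x₀).differentiableOn (by simp)) hy ht
  exact DFunLike.congr_fun (h1.unique h2) w

lemma IsSolution.gram_pos (hX : IsSolution α T X) (hy : y ∈ (extChartAt (𝓡 2) x₀).target)
    (ht : t ∈ Ico 0 T) {S : Set (EuclideanSpace ℝ (Fin 2) × ℝ)}
    (hS : S = (extChartAt (𝓡 2) x₀).target ×ˢ Ico 0 T) :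
    0 < inner ℝ (spat S b₁ (inChart X x₀) (y, t)) (spat S b₁ (inChart X x₀) (y, t))
      * inner ℝ (spat S b₂ (inChart X x₀) (y, t)) (spat S b₂ (inChart X x₀) (y, t))
      - inner ℝ (spat S b₁ (inChart X x₀) (y, t)) (spat S b₂ (inChart X x₀) (y, t)) ^ 2 := by
  subst hS
  obtain ⟨L, hL, hLX, -⟩ := hX.exists_frame hy ht
  refine gram_det_pos fun s r hsr => smul_add_smul_eq_zero ?_
  have h : diff (X t) ((extChartAt (𝓡 2) x₀).symm y) (L (s • b₁ + r • b₂)) = 0 := by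
    rw [map_add, map_smul, map_smul, map_add, map_smul, map_smul, hLX, hLX]
    exact hsr
  exact (map_eq_zero_iff L hL.1).1
    ((map_eq_zero_iff _ ((hX.strictlyConvex t ht).immersion _)).1 h)

/-- The outer unit normal is continuous in space and time, and differentiable in space. Locally it
is the normalization of the component of a fixed normal vector orthogonal to the tangent plane;
the sign is determined by a point of the surface off the tangent plane. -/
lemma IsSolution.normalInChart_regular (hX : IsSolution α T X)
    (hy : y ∈ (extChartAt (𝓡 2) x₀).target) (ht : t ∈ Ico 0 T) :
    ContinuousWithinAt (normalInChart X x₀) ((extChartAt (𝓡 2) x₀).target ×ˢ Ico 0 T) (y, t) ∧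
      DifferentiableAt ℝ (fun z => normalInChart X x₀ (z, t)) y := by
  obtain ⟨U, hU⟩ : ∃ U, U = (extChartAt (𝓡 2) x₀).target := ⟨_, rfl⟩
  obtain ⟨S, hS⟩ : ∃ S, S = (extChartAt (𝓡 2) x₀).target ×ˢ Ico 0 T := ⟨_, rfl⟩
  have hUo : IsOpen (extChartAt (𝓡 2) x₀).target := isOpen_extChartAt_target x₀
  have hJ := uniqueDiffOn_Ico 0 T
  have hY := hX.contDiffOn_inChart x₀
  have hY1 := contDiffOn_spat hUo hJ hY b₁
  have hY2 := contDiffOn_spat hUo hJ hY b₂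
  rw [← hS] at hY hY1 hY2 ⊢
  have hmem : (y, t) ∈ S := hS ▸ ⟨hy, ht⟩
  set Y := inChart X x₀
  set Y1 := spat S b₁ Y
  set Y2 := spat S b₂ Y
  set ν := normalInChart X x₀
  obtain ⟨n₀, hn₀⟩ : ∃ n₀, n₀ = ν (y, t) := ⟨_, rfl⟩
  -- `m` is the component of `n₀` orthogonal to `Y1` and `Y2`, times the Gram determinant
  let g : EuclideanSpace ℝ (Fin 2) × ℝ → ℝ := fun p =>
    inner ℝ (Y1 p) (Y1 p) * inner ℝ (Y2 p) (Y2 p) - inner ℝ (Y1 p) (Y2 p) ^ 2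
  let m : EuclideanSpace ℝ (Fin 2) × ℝ → E3 := fun p => g p • n₀
    - ((inner ℝ (Y2 p) (Y2 p) * inner ℝ (Y1 p) n₀ - inner ℝ (Y1 p) (Y2 p) * inner ℝ (Y2 p) n₀)
        • Y1 p
      + (inner ℝ (Y1 p) (Y1 p) * inner ℝ (Y2 p) n₀ - inner ℝ (Y1 p) (Y2 p) * inner ℝ (Y1 p) n₀)
        • Y2 p)
  have i11 := hY1.inner ℝ hY1
  have i12 := hY1.inner ℝ hY2
  have i22 := hY2.inner ℝ hY2
  have i1 := hY1.inner ℝ (contDiffOn_const (c := n₀))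
  have i2 := hY2.inner ℝ (contDiffOn_const (c := n₀))
  have hm : ContDiffOn ℝ ∞ m S :=
    (((i11.mul i22).sub (i12.pow 2)).smul contDiffOn_const).sub
      ((((i22.mul i1).sub (i12.mul i2)).smul hY1).add (((i11.mul i2).sub (i12.mul i1)).smul hY2))
  have hmperp : ∀ p, inner ℝ (Y1 p) (m p) = 0 ∧ inner ℝ (Y2 p) (m p) = 0 := by
    intro p
    simp only [m, g, inner_sub_right, inner_add_right, real_inner_smul_right,
      real_inner_comm (Y1 p) (Y2 p)]
    constructor <;> ring
  have hnu : ∀ p ∈ S, IsOuterUnitNormal (X p.2) ((extChartAt (𝓡 2) x₀).symm p.1) (ν p) := by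
    intro p hp
    rw [hS] at hp
    exact (hX.strictlyConvex p.2 hp.2).outerUnitNormal_spec (hX.mdifferentiable hp.2) _
  have hm0 : m (y, t) = g (y, t) • n₀ := by
    obtain ⟨L, hL, hLX, -⟩ := hX.exists_frame hy ht
    rw [← hS] at hLX
    have o := (hnu _ hmem).orthogonal
    have o1 := o (L b₁)
    have o2 := o (L b₂)
    rw [hLX, ← hn₀] at o1 o2
    simp only [m]
    rw [show inner ℝ (Y1 (y, t)) n₀ = 0 from o1, show inner ℝ (Y2 (y, t)) n₀ = 0 from o2]
    simp
  have hg0 : 0 < g (y, t) := hX.gram_pos hy ht hS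
  have hn₀1 : ‖n₀‖ = 1 := by rw [hn₀]; exact (hnu _ hmem).norm_eq_one
  have hmne : m (y, t) ≠ 0 := by
    rw [hm0]
    exact smul_ne_zero hg0.ne' (by rintro h; simp [h] at hn₀1)
  -- a point strictly below the tangent plane
  obtain ⟨z, hz⟩ := (hX.strictlyConvex t ht).exists_inner_neg
    (x := (extChartAt (𝓡 2) x₀).symm y) (n := n₀) (by rintro h; simp [h] at hn₀1)
    (by rw [hn₀]; exact (hnu _ hmem).outward)
  have hzc : ContinuousWithinAt (fun p : EuclideanSpace ℝ (Fin 2) × ℝ => X p.2 z) S (y, t) := by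
    have h1 : ContinuousOn (fun p : EuclideanSpace ℝ (Fin 2) × ℝ => X p.2 z) S := by
      refine hX.smooth.continuousOn.comp
        (f := fun p : EuclideanSpace ℝ (Fin 2) × ℝ => (z, p.2)) (by fun_prop) ?_
      intro p hp
      rw [hS] at hp
      exact ⟨mem_univ _, hp.2⟩
    exact h1 _ hmem
  have hmc : ContinuousWithinAt m S (y, t) := hm.continuousOn _ hmem
  have hneg : ∀ᶠ p in 𝓝[S] (y, t), inner ℝ (X p.2 z - Y p) (m p) < 0 := by
    have hc : ContinuousWithinAt (fun p => inner ℝ (X p.2 z - Y p) (m p)) S (y, t) :=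
      (hzc.sub (hY.continuousOn _ hmem)).inner hmc
    refine hc.eventually_lt_const ?_
    change inner ℝ (X t z - Y (y, t)) (m (y, t)) < 0
    rw [hm0, inner_smul_right]
    exact mul_neg_of_pos_of_neg hg0 hz
  have hne : ∀ᶠ p in 𝓝[S] (y, t), m p ≠ 0 := hmc.eventually_ne hmne
  have heq : ν =ᶠ[𝓝[S] (y, t)] fun p => ‖m p‖⁻¹ • m p := by
    filter_upwards [hneg, hne, self_mem_nhdsWithin] with p hp1 hp2 hp3
    have hp3' := hp3
    rw [hS] at hp3'
    obtain ⟨L, hL, hLX, -⟩ := hX.exists_frame hp3'.1 hp3'.2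
    rw [← hS] at hLX
    refine (hX.strictlyConvex p.2 hp3'.2).outerUnitNormal_eq (hX.mdifferentiable hp3'.2) ?_ ?_
      ⟨z, ?_⟩
    · rw [norm_smul, norm_inv, norm_norm, inv_mul_cancel₀ (norm_ne_zero_iff.2 hp2)]
    · intro v
      obtain ⟨w, rfl⟩ := hL.2 v
      rw [eq_smul_add_smul w, map_add, map_smul, map_smul, map_add, map_smul, map_smul, hLX, hLX,
        inner_add_left, real_inner_smul_left, real_inner_smul_left, real_inner_smul_right,
        real_inner_smul_right]
      rw [show inner ℝ (spat S b₁ (inChart X x₀) (p.1, p.2)) (m p) = 0 from (hmperp p).1,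
        show inner ℝ (spat S b₂ (inChart X x₀) (p.1, p.2)) (m p) = 0 from (hmperp p).2]
      simp
    · rw [inner_smul_right]
      exact mul_neg_of_pos_of_neg (by positivity) hp1
  constructor
  · refine ContinuousWithinAt.congr_of_eventuallyEq ?_ heq (heq.self_of_nhdsWithin hmem)
    exact (hmc.norm.inv₀ (norm_ne_zero_iff.2 hmne)).smul hmc
  · have ht' : Tendsto (fun z : EuclideanSpace ℝ (Fin 2) => (z, t)) (𝓝 y) (𝓝[S] (y, t)) := by
      rw [hS]
      exact tendsto_slice hUo hy ht
    have hd : DifferentiableAt ℝ (fun z => m (z, t)) y := by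
      rw [hS] at hm
      exact (hasFDerivAt_slice hUo (hm.differentiableOn (by simp)) hy ht).differentiableAt
    exact (((hd.norm ℝ hmne).inv (norm_ne_zero_iff.2 hmne)).smul hd).congr_of_eventuallyEq
      (ht'.eventually heq)

end ChartPoint

end GaussFlow

namespace GaussFlow

open Filter Topology

/-! ### Continuity of the pinching quantity up to the initial time -/

variable {M : Type*} [TopologicalSpace M] [ChartedSpace (EuclideanSpace ℝ (Fin 2)) M]
  [IsManifold (𝓡 2) ∞ M] {α T : ℝ} {X : ℝ → M → E3}

section ChartPoint

variable {x₀ : M} {y : EuclideanSpace ℝ (Fin 2)} {t : ℝ}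

lemma IsSolution.mdifferentiableAt_normal (hX : IsSolution α T X) (ht : t ∈ Ico 0 T) (x : M) :
    MDifferentiableAt (𝓡 2) 𝓘(ℝ, E3) (outerUnitNormal (X t)) x :=
  mdifferentiableAt_of_chart (mem_extChartAt_source x)
    (hX.normalInChart_regular (mem_extChartAt_target x) ht).2

/-- The second fundamental form in a chart, as minus the normal part of the second derivatives. -/
lemma IsSolution.inner_diff_normal (hX : IsSolution α T X)
    (hy : y ∈ (extChartAt (𝓡 2) x₀).target) (ht : t ∈ Ico 0 T)
    {S : Set (EuclideanSpace ℝ (Fin 2) × ℝ)} (hS : S = (extChartAt (𝓡 2) x₀).target ×ˢ Ico 0 T)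
    {L : EuclideanSpace ℝ (Fin 2) →L[ℝ] TangentSpace (𝓡 2) ((extChartAt (𝓡 2) x₀).symm y)}
    (hL : ∀ f : M → E3, MDifferentiableAt (𝓡 2) 𝓘(ℝ, E3) f ((extChartAt (𝓡 2) x₀).symm y) →
        HasFDerivAt (f ∘ (extChartAt (𝓡 2) x₀).symm)
          ((diff f ((extChartAt (𝓡 2) x₀).symm y)).comp L) y)
    (w w' : EuclideanSpace ℝ (Fin 2)) :
    inner ℝ (diff (outerUnitNormal (X t)) ((extChartAt (𝓡 2) x₀).symm y) (L w))
        (spat S w' (inChart X x₀) (y, t))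
      = -inner ℝ (normalInChart X x₀ (y, t)) (spat S w (spat S w' (inChart X x₀)) (y, t)) := by
  have hUo : IsOpen (extChartAt (𝓡 2) x₀).target := isOpen_extChartAt_target x₀
  have h1 := hL _ (hX.mdifferentiableAt_normal ht _)
  have hsp := (contDiffOn_spat hUo (uniqueDiffOn_Ico 0 T) (hX.contDiffOn_inChart x₀)
    w').differentiableOn (by simp)
  have h2 := hasFDerivAt_slice hUo hsp hy ht
  have h3 := h1.inner ℝ h2
  have h4 : (fun z => inner ℝ ((outerUnitNormal (X t) ∘ (extChartAt (𝓡 2) x₀).symm) z)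
      (spat ((extChartAt (𝓡 2) x₀).target ×ˢ Ico 0 T) w' (inChart X x₀) (z, t))) =ᶠ[𝓝 y]
      fun _ => (0 : ℝ) := by
    filter_upwards [hUo.mem_nhds hy] with z hz
    obtain ⟨L', -, hLX', -⟩ := hX.exists_frame hz ht
    rw [← hLX', real_inner_comm]
    exact ((hX.strictlyConvex t ht).outerUnitNormal_spec (hX.mdifferentiable ht) _).orthogonal _
  have h5 := (h3.congr_of_eventuallyEq h4.symm).unique (hasFDerivAt_const (0 : ℝ) y)
  have h6 := DFunLike.congr_fun h5 w
  simp only [ContinuousLinearMap.comp_apply, fderivInnerCLM_apply, ContinuousLinearMap.prod_apply,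
    zero_apply] at h6
  subst hS
  have h7 : inner ℝ (normalInChart X x₀ (y, t)) (spat ((extChartAt (𝓡 2) x₀).target ×ˢ Ico 0 T) w
      (spat ((extChartAt (𝓡 2) x₀).target ×ˢ Ico 0 T) w' (inChart X x₀)) (y, t))
      + inner ℝ (diff (outerUnitNormal (X t)) ((extChartAt (𝓡 2) x₀).symm y) (L w))
        (spat ((extChartAt (𝓡 2) x₀).target ×ˢ Ico 0 T) w' (inChart X x₀) (y, t)) = 0 := h6
  linarith

end ChartPoint

/-- The first fundamental form of the flow in a chart. -/
noncomputable def firstForm (S : Set (EuclideanSpace ℝ (Fin 2) × ℝ)) (X : ℝ → M → E3) (x₀ : M)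
    (w w' : EuclideanSpace ℝ (Fin 2)) (p : EuclideanSpace ℝ (Fin 2) × ℝ) : ℝ :=
  inner ℝ (spat S w (inChart X x₀) p) (spat S w' (inChart X x₀) p)

/-- The second fundamental form of the flow in a chart. -/
noncomputable def secondForm (S : Set (EuclideanSpace ℝ (Fin 2) × ℝ)) (X : ℝ → M → E3) (x₀ : M)
    (w w' : EuclideanSpace ℝ (Fin 2)) (p : EuclideanSpace ℝ (Fin 2) × ℝ) : ℝ :=
  -inner ℝ (normalInChart X x₀ p) (spat S w (spat S w' (inChart X x₀)) p)

lemma IsSolution.curvatures_inChart (hX : IsSolution α T X) {x₀ : M}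
    {S : Set (EuclideanSpace ℝ (Fin 2) × ℝ)} (hS : S = (extChartAt (𝓡 2) x₀).target ×ˢ Ico 0 T)
    {p : EuclideanSpace ℝ (Fin 2) × ℝ} (hp : p ∈ S) {x : M}
    (hx : x = (extChartAt (𝓡 2) x₀).symm p.1) :
    0 < firstForm S X x₀ b₁ b₁ p * firstForm S X x₀ b₂ b₂ p - firstForm S X x₀ b₁ b₂ p ^ 2 ∧
    meanCurvature (X p.2) x
      * (firstForm S X x₀ b₁ b₁ p * firstForm S X x₀ b₂ b₂ p - firstForm S X x₀ b₁ b₂ p ^ 2)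
      = firstForm S X x₀ b₁ b₁ p * secondForm S X x₀ b₂ b₂ p
        + firstForm S X x₀ b₂ b₂ p * secondForm S X x₀ b₁ b₁ p
        - 2 * firstForm S X x₀ b₁ b₂ p * secondForm S X x₀ b₁ b₂ p ∧
    gaussCurvature (X p.2) x
      * (firstForm S X x₀ b₁ b₁ p * firstForm S X x₀ b₂ b₂ p - firstForm S X x₀ b₁ b₂ p ^ 2)
      = secondForm S X x₀ b₁ b₁ p * secondForm S X x₀ b₂ b₂ p - secondForm S X x₀ b₁ b₂ p ^ 2 ∧
    0 < gaussCurvature (X p.2) x ∧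
    0 ≤ meanCurvature (X p.2) x ^ 2 - 4 * gaussCurvature (X p.2) x ∧
    (∀ α, pinching α (X p.2) x = (meanCurvature (X p.2) x ^ 2 - 4 * gaussCurvature (X p.2) x)
      * gaussCurvature (X p.2) x ^ (α - 2)) ∧
    (weingartenMap (X p.2) x).charpoly = Polynomial.X ^ 2
      - Polynomial.C (meanCurvature (X p.2) x) * Polynomial.X
      + Polynomial.C (gaussCurvature (X p.2) x) := by
  subst hx
  obtain ⟨y, t⟩ := p
  have hp' := hp
  rw [hS] at hp'
  obtain ⟨hy, ht⟩ := hp'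
  have hUo : IsOpen (extChartAt (𝓡 2) x₀).target := isOpen_extChartAt_target x₀
  obtain ⟨L, hL, hLX, hLf⟩ := hX.exists_frame hy ht
  have hg := hX.gram_pos hy ht hS
  have hsym : spat S b₂ (spat S b₁ (inChart X x₀)) (y, t)
      = spat S b₁ (spat S b₂ (inChart X x₀)) (y, t) := by
    rw [hS]
    exact spat_spat_comm hUo (uniqueDiffOn_Ico 0 T) (hX.contDiffOn_inChart x₀) hy ht _ _
  have hh := fun w w' => hX.inner_diff_normal hy ht hS hLf w w'
  rw [← hS] at hLX
  have hh21 := hh b₂ b₁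
  rw [hsym] at hh21
  obtain ⟨c1, c2, c3, c4, c5⟩ := curvatures_of_frame (hX.strictlyConvex t ht)
    (hX.mdifferentiable ht) (hX.mdifferentiableAt_normal ht _) (v₁ := L b₁) (v₂ := L b₂)
    (g11 := firstForm S X x₀ b₁ b₁ (y, t))
    (g12 := firstForm S X x₀ b₁ b₂ (y, t))
    (g22 := firstForm S X x₀ b₂ b₂ (y, t))
    (h11 := secondForm S X x₀ b₁ b₁ (y, t))
    (h12 := secondForm S X x₀ b₁ b₂ (y, t))
    (h22 := secondForm S X x₀ b₂ b₂ (y, t))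
    (by rw [hLX]; rfl) (by rw [hLX, hLX]; rfl) (by rw [hLX]; rfl)
    (by rw [hLX]; exact hh b₁ b₁) (by rw [hLX]; exact hh b₁ b₂)
    (by rw [hLX]; exact hh21) (by rw [hLX]; exact hh b₂ b₂) hg
  exact ⟨hg, c1, c2, c3, c4, fun α => pinching_eq c5 c3 c4, c5⟩

lemma IsSolution.curvature_facts (hX : IsSolution α T X) {t : ℝ} (ht : t ∈ Ico 0 T) (x : M) :
    0 < gaussCurvature (X t) x ∧
    0 ≤ meanCurvature (X t) x ^ 2 - 4 * gaussCurvature (X t) x ∧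
    (∀ α, pinching α (X t) x = (meanCurvature (X t) x ^ 2 - 4 * gaussCurvature (X t) x)
      * gaussCurvature (X t) x ^ (α - 2)) ∧
    (weingartenMap (X t) x).charpoly = Polynomial.X ^ 2
      - Polynomial.C (meanCurvature (X t) x) * Polynomial.X
      + Polynomial.C (gaussCurvature (X t) x) := by
  obtain ⟨-, -, -, h⟩ := hX.curvatures_inChart (x₀ := x) (p := (extChartAt (𝓡 2) x x, t)) rfl
    ⟨mem_extChartAt_target x, ht⟩ (extChartAt_to_inv x).symm
  exact h

omit [IsManifold (𝓡 2) ∞ M] in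
/-- Continuity on space-time can be checked in charts. -/
lemma continuousWithinAt_of_chart {Z : Type*} [TopologicalSpace Z] {f : M × ℝ → Z} {x₀ : M}
    {t : ℝ} (h : ContinuousWithinAt
      (fun p : EuclideanSpace ℝ (Fin 2) × ℝ => f ((extChartAt (𝓡 2) x₀).symm p.1, p.2))
      ((extChartAt (𝓡 2) x₀).target ×ˢ Ico 0 T) (extChartAt (𝓡 2) x₀ x₀, t)) :
    ContinuousWithinAt f (univ ×ˢ Ico 0 T) (x₀, t) := by
  have hsrc : ∀ᶠ q : M × ℝ in 𝓝[univ ×ˢ Ico 0 T] (x₀, t), q.1 ∈ (extChartAt (𝓡 2) x₀).source :=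
    nhdsWithin_le_nhds (continuous_fst.continuousAt.eventually
      (extChartAt_source_mem_nhds (I := 𝓡 2) x₀))
  have hc : Tendsto (fun q : M × ℝ => (extChartAt (𝓡 2) x₀ q.1, q.2))
      (𝓝[univ ×ˢ Ico 0 T] (x₀, t))
      (𝓝[(extChartAt (𝓡 2) x₀).target ×ˢ Ico 0 T] (extChartAt (𝓡 2) x₀ x₀, t)) := by
    refine tendsto_nhdsWithin_iff.2 ⟨?_, ?_⟩
    · refine Tendsto.mono_left ?_ nhdsWithin_le_nhds
      have h1 : ContinuousAt (fun q : M × ℝ => (extChartAt (𝓡 2) x₀ q.1, q.2)) (x₀, t) :=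
        ((continuousAt_extChartAt (I := 𝓡 2) x₀).comp (x := (x₀, t)) continuousAt_fst).prodMk
          continuousAt_snd
      exact h1
    · filter_upwards [hsrc, self_mem_nhdsWithin] with q hq1 hq2
      exact ⟨(extChartAt (𝓡 2) x₀).map_source hq1, hq2.2⟩
  have h2 := h.tendsto.comp hc
  simp only [extChartAt_to_inv] at h2
  refine h2.congr' ?_
  filter_upwards [hsrc] with q hq
  simp only [Function.comp_apply, (extChartAt (𝓡 2) x₀).left_inv hq]

lemma IsSolution.continuousOn_normal (hX : IsSolution α T X) :
    ContinuousOn (fun q : M × ℝ => outerUnitNormal (X q.2) q.1) (univ ×ˢ Ico 0 T) := by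
  rintro ⟨x₀, t⟩ ⟨-, ht⟩
  exact continuousWithinAt_of_chart (hX.normalInChart_regular (mem_extChartAt_target x₀) ht).1

theorem IsSolution.continuousOn_pinching (hX : IsSolution α T X) :
    ContinuousOn (fun q : M × ℝ => pinching α (X q.2) q.1) (univ ×ˢ Ico 0 T) := by
  rintro ⟨x₀, t⟩ ⟨-, ht⟩
  apply continuousWithinAt_of_chart
  obtain ⟨S, hS⟩ : ∃ S, S = (extChartAt (𝓡 2) x₀).target ×ˢ Ico 0 T := ⟨_, rfl⟩
  have hUo : IsOpen (extChartAt (𝓡 2) x₀).target := isOpen_extChartAt_target x₀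
  have hJ := uniqueDiffOn_Ico 0 T
  have c1 := fun w => contDiffOn_spat hUo hJ (hX.contDiffOn_inChart x₀) w
  have c2 := fun w w' => contDiffOn_spat hUo hJ (c1 w') w
  have hn : ContinuousOn (normalInChart X x₀) S := by
    rintro ⟨y, s⟩ hp
    rw [hS] at hp ⊢
    exact (hX.normalInChart_regular hp.1 hp.2).1
  rw [← hS] at c1 c2 ⊢
  have hmem : (extChartAt (𝓡 2) x₀ x₀, t) ∈ S := hS ▸ ⟨mem_extChartAt_target x₀, ht⟩
  have f1 : ∀ w w', ContinuousOn (firstForm S X x₀ w w') S := fun w w' =>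
    (c1 w).continuousOn.inner (c1 w').continuousOn
  have f2 : ∀ w w', ContinuousOn (secondForm S X x₀ w w') S := fun w w' =>
    (hn.inner (c2 w w').continuousOn).neg
  have hfacts := fun p (hp : p ∈ S) => hX.curvatures_inChart hS hp rfl
  have cg : ContinuousOn (fun p => firstForm S X x₀ b₁ b₁ p * firstForm S X x₀ b₂ b₂ p
      - firstForm S X x₀ b₁ b₂ p ^ 2) S := ((f1 _ _).mul (f1 _ _)).sub ((f1 _ _).pow 2)
  have cH : ContinuousOn (fun p : EuclideanSpace ℝ (Fin 2) × ℝ =>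
      meanCurvature (X p.2) ((extChartAt (𝓡 2) x₀).symm p.1)) S := by
    refine ContinuousOn.congr (f := fun p => (firstForm S X x₀ b₁ b₁ p * secondForm S X x₀ b₂ b₂ p
        + firstForm S X x₀ b₂ b₂ p * secondForm S X x₀ b₁ b₁ p
        - 2 * firstForm S X x₀ b₁ b₂ p * secondForm S X x₀ b₁ b₂ p) / (firstForm S X x₀ b₁ b₁ p
        * firstForm S X x₀ b₂ b₂ p - firstForm S X x₀ b₁ b₂ p ^ 2)) ?_ ?_
    · refine ContinuousOn.div ?_ cg fun p hp => (hfacts p hp).1.ne'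
      exact (((f1 _ _).mul (f2 _ _)).add ((f1 _ _).mul (f2 _ _))).sub
        ((continuousOn_const.mul (f1 _ _)).mul (f2 _ _))
    · intro p hp
      obtain ⟨h0, h1, -⟩ := hfacts p hp
      exact (eq_div_iff h0.ne').2 h1
  have cK : ContinuousOn (fun p : EuclideanSpace ℝ (Fin 2) × ℝ =>
      gaussCurvature (X p.2) ((extChartAt (𝓡 2) x₀).symm p.1)) S := by
    refine ContinuousOn.congr (f := fun p => (secondForm S X x₀ b₁ b₁ p
        * secondForm S X x₀ b₂ b₂ p - secondForm S X x₀ b₁ b₂ p ^ 2) / (firstForm S X x₀ b₁ b₁ p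
        * firstForm S X x₀ b₂ b₂ p - firstForm S X x₀ b₁ b₂ p ^ 2)) ?_ ?_
    · refine ContinuousOn.div ?_ cg fun p hp => (hfacts p hp).1.ne'
      exact ((f2 _ _).mul (f2 _ _)).sub ((f2 _ _).pow 2)
    · intro p hp
      obtain ⟨h0, -, h1, -⟩ := hfacts p hp
      exact (eq_div_iff h0.ne').2 h1
  have cQ : ContinuousOn (fun p : EuclideanSpace ℝ (Fin 2) × ℝ =>
      pinching α (X p.2) ((extChartAt (𝓡 2) x₀).symm p.1)) S := by
    refine ContinuousOn.congr
      (f := fun p => (meanCurvature (X p.2) ((extChartAt (𝓡 2) x₀).symm p.1) ^ 2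
        - 4 * gaussCurvature (X p.2) ((extChartAt (𝓡 2) x₀).symm p.1))
        * gaussCurvature (X p.2) ((extChartAt (𝓡 2) x₀).symm p.1) ^ (α - 2))
      (((cH.pow 2).sub (continuousOn_const.mul cK)).mul (cK.rpow_const
        fun p hp => .inl (hfacts p hp).2.2.2.1.ne')) ?_
    intro p hp
    exact (hfacts p hp).2.2.2.2.2.1 α
  exact cQ _ hmem

end GaussFlow

namespace GaussFlow

open Filter Topology

/-! ### Principal directions -/

variable {M : Type*} [TopologicalSpace M] [ChartedSpace (EuclideanSpace ℝ (Fin 2)) M]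
  [IsManifold (𝓡 2) ∞ M] {α T : ℝ} {X : ℝ → M → E3}

lemma IsSolution.secondFundamentalForm_symm (hX : IsSolution α T X) {t : ℝ} (ht : t ∈ Ico 0 T)
    {x : M} (v w : TangentSpace (𝓡 2) x) :
    secondFundamentalForm (X t) x v w = secondFundamentalForm (X t) x w v := by
  obtain ⟨x₀, y, hy, rfl⟩ : ∃ x₀, ∃ y ∈ (extChartAt (𝓡 2) x₀).target,
      x = (extChartAt (𝓡 2) x₀).symm y :=
    ⟨x, _, mem_extChartAt_target x, (extChartAt_to_inv x).symm⟩
  obtain ⟨L, hL, hLX, hLf⟩ := hX.exists_frame hy ht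
  obtain ⟨v, rfl⟩ := hL.2 v
  obtain ⟨w, rfl⟩ := hL.2 w
  rw [secondFundamentalForm, secondFundamentalForm, hLX, hLX, hX.inner_diff_normal hy ht rfl hLf,
    hX.inner_diff_normal hy ht rfl hLf, spat_spat_comm (isOpen_extChartAt_target x₀)
      (uniqueDiffOn_Ico 0 T) (hX.contDiffOn_inChart x₀) hy ht]

/-- Away from umbilic points there is an orthonormal frame of principal directions, with distinct
positive principal curvatures. -/
lemma IsSolution.exists_principal_frame (hX : IsSolution α T X) {t : ℝ} (ht : t ∈ Ico 0 T) {x : M}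
    (hne : 0 < meanCurvature (X t) x ^ 2 - 4 * gaussCurvature (X t) x) :
    ∃ (v₁ v₂ : TangentSpace (𝓡 2) x) (k₁ k₂ : ℝ), 0 < k₁ ∧ 0 < k₂ ∧ k₁ ≠ k₂ ∧
      ‖diff (X t) x v₁‖ = 1 ∧ ‖diff (X t) x v₂‖ = 1 ∧
      inner ℝ (diff (X t) x v₁) (diff (X t) x v₂) = 0 ∧
      secondFundamentalForm (X t) x v₁ v₁ = k₁ ∧ secondFundamentalForm (X t) x v₁ v₂ = 0 ∧
      secondFundamentalForm (X t) x v₂ v₂ = k₂ := by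
  obtain ⟨-, -, -, hc⟩ := hX.curvature_facts ht x
  set H := meanCurvature (X t) x
  set K := gaussCurvature (X t) x
  set s := Real.sqrt (H ^ 2 - 4 * K) with hs
  have hss : s ^ 2 = H ^ 2 - 4 * K := Real.sq_sqrt hne.le
  have hs0 : 0 < s := Real.sqrt_pos.2 hne
  have hW := diff_weingartenMap (hX.strictlyConvex t ht) (hX.mdifferentiable ht)
    (hX.mdifferentiableAt_normal ht x)
  have hinj := (hX.strictlyConvex t ht).immersion x
  -- a unit eigenvector for each root of the characteristic polynomial
  have key : ∀ k : ℝ, k ^ 2 - H * k + K = 0 → ∃ v : TangentSpace (𝓡 2) x,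
      v ≠ 0 ∧ ‖diff (X t) x v‖ = 1 ∧
      diff (outerUnitNormal (X t)) x v = k • diff (X t) x v := by
    intro k hk
    have hroot : (weingartenMap (X t) x).charpoly.IsRoot k := by
      rw [hc]
      simp only [Polynomial.IsRoot.def, Polynomial.eval_add, Polynomial.eval_sub,
        Polynomial.eval_pow, Polynomial.eval_X, Polynomial.eval_mul, Polynomial.eval_C]
      exact hk
    obtain ⟨w, hw⟩ :=
      ((Module.End.hasEigenvalue_iff_isRoot_charpoly _ _).2 hroot).exists_hasEigenvector
    have hw0 : w ≠ 0 := hw.2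
    have hwW : weingartenMap (X t) x w = k • w := hw.apply_eq_smul
    have hAw : diff (X t) x w ≠ 0 := fun h => hw0 (hinj (by rw [h, map_zero]))
    have hn : ‖diff (X t) x w‖ ≠ 0 := norm_ne_zero_iff.2 hAw
    refine ⟨‖diff (X t) x w‖⁻¹ • w, smul_ne_zero (inv_ne_zero hn) hw0, ?_, ?_⟩
    · rw [map_smul, norm_smul, norm_inv, norm_norm, inv_mul_cancel₀ hn]
    · rw [← hW, map_smul, hwW, map_smul, map_smul, map_smul, smul_comm]
  obtain ⟨v₁, h01, hn1, hB1⟩ := key ((H - s) / 2) (by linear_combination hss / 4)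
  obtain ⟨v₂, h02, hn2, hB2⟩ := key ((H + s) / 2) (by linear_combination hss / 4)
  have f11 : secondFundamentalForm (X t) x v₁ v₁ = (H - s) / 2 := by
    rw [secondFundamentalForm, hB1, real_inner_smul_left, real_inner_self_eq_norm_sq, hn1]
    ring
  have f22 : secondFundamentalForm (X t) x v₂ v₂ = (H + s) / 2 := by
    rw [secondFundamentalForm, hB2, real_inner_smul_left, real_inner_self_eq_norm_sq, hn2]
    ring
  have horth : inner ℝ (diff (X t) x v₁) (diff (X t) x v₂) = 0 := by
    have h := hX.secondFundamentalForm_symm ht v₁ v₂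
    rw [secondFundamentalForm, secondFundamentalForm, hB1, hB2, real_inner_smul_left,
      real_inner_smul_left, real_inner_comm (diff (X t) x v₁)] at h
    have h2 : s * inner ℝ (diff (X t) x v₁) (diff (X t) x v₂) = 0 := by linarith
    exact (mul_eq_zero.1 h2).resolve_left hs0.ne'
  have f12 : secondFundamentalForm (X t) x v₁ v₂ = 0 := by
    rw [secondFundamentalForm, hB1, real_inner_smul_left, horth, mul_zero]
  have p1 := (hX.strictlyConvex t ht).posDef x v₁ h01
  have p2 := (hX.strictlyConvex t ht).posDef x v₂ h02
  rw [f11] at p1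
  rw [f22] at p2
  exact ⟨v₁, v₂, _, _, p1, p2, by intro h; linarith, hn1, hn2, horth, f11, f12, f22⟩

end GaussFlow

namespace GaussFlow

open Filter Topology

/-! ### The flow as a moving graph -/

variable {M : Type*} [TopologicalSpace M] [ChartedSpace (EuclideanSpace ℝ (Fin 2)) M]
  {α T : ℝ} {X : ℝ → M → E3} {u : ℝ × ℝ × ℝ → ℝ}

/-- The base point of the surface point `X q.2 q.1`, when the surface is viewed as a graph in the
direction `e 2` over the plane spanned by `e 0` and `e 1`; the last coordinate is time. -/
noncomputable def basePoint (e : OrthonormalBasis (Fin 3) ℝ E3) (X : ℝ → M → E3) (q : M × ℝ) :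
    ℝ × ℝ × ℝ :=
  (inner ℝ (e 0) (X q.2 q.1), inner ℝ (e 1) (X q.2 q.1), q.2)

/-- The linear part of the projection to the base plane. -/
noncomputable def toPlane (e : OrthonormalBasis (Fin 3) ℝ E3) : E3 →L[ℝ] ℝ × ℝ × ℝ :=
  (innerSL ℝ (e 0)).prod ((innerSL ℝ (e 1)).prod 0)

lemma toPlane_apply (e : OrthonormalBasis (Fin 3) ℝ E3) (w : E3) :
    toPlane e w = inner ℝ (e 0) w • ex + inner ℝ (e 1) w • ey := by
  simp [toPlane, ex, ey]

lemma hasFDerivAt_toPlane (e : OrthonormalBasis (Fin 3) ℝ E3) (t : ℝ) (w : E3) :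
    HasFDerivAt (fun w => ((inner ℝ (e 0) w, inner ℝ (e 1) w, t) : ℝ × ℝ × ℝ)) (toPlane e) w :=
  ((innerSL ℝ (e 0)).hasFDerivAt).prodMk
    (((innerSL ℝ (e 1)).hasFDerivAt).prodMk (hasFDerivAt_const t w))

/-- The flow is the graph of `u` near `q`. -/
def IsGraphAt (e : OrthonormalBasis (Fin 3) ℝ E3) (X : ℝ → M → E3) (u : ℝ × ℝ × ℝ → ℝ)
    (q : M × ℝ) : Prop :=
  ∀ᶠ q' in 𝓝 q, inner ℝ (e 2) (X q'.2 q'.1) = u (basePoint e X q')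

/-- The downward unit normal of the graph of `u`. -/
noncomputable def graphNormal (e : OrthonormalBasis (Fin 3) ℝ E3) (u : ℝ × ℝ × ℝ → ℝ)
    (p : ℝ × ℝ × ℝ) : E3 :=
  (Real.sqrt (areaSq (pd ex u p) (pd ey u p)))⁻¹ • (pd ex u p • e 0 + pd ey u p • e 1 - e 2)

lemma inner_eq_sum (e : OrthonormalBasis (Fin 3) ℝ E3) (v w : E3) :
    inner ℝ v w = inner ℝ (e 0) v * inner ℝ (e 0) w + inner ℝ (e 1) v * inner ℝ (e 1) w
      + inner ℝ (e 2) v * inner ℝ (e 2) w := by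
  rw [← e.sum_inner_mul_inner v w, Fin.sum_univ_three]
  simp only [real_inner_comm]

lemma inner_graphNormal (e : OrthonormalBasis (Fin 3) ℝ E3) (p : ℝ × ℝ × ℝ) :
    inner ℝ (e 0) (graphNormal e u p)
        = (Real.sqrt (areaSq (pd ex u p) (pd ey u p)))⁻¹ * pd ex u p ∧
      inner ℝ (e 1) (graphNormal e u p)
        = (Real.sqrt (areaSq (pd ex u p) (pd ey u p)))⁻¹ * pd ey u p ∧
      inner ℝ (e 2) (graphNormal e u p)
        = -(Real.sqrt (areaSq (pd ex u p) (pd ey u p)))⁻¹ := by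
  refine ⟨?_, ?_, ?_⟩ <;>
    simp [graphNormal, inner_smul_right, inner_sub_right, inner_add_right]

lemma areaSq_pos (a b : ℝ) : 0 < areaSq a b := by
  rw [areaSq]
  nlinarith [sq_nonneg a, sq_nonneg b]

lemma norm_graphNormal (e : OrthonormalBasis (Fin 3) ℝ E3) (p : ℝ × ℝ × ℝ) :
    ‖graphNormal e u p‖ = 1 := by
  obtain ⟨h0, h1, h2⟩ := inner_graphNormal (u := u) e p
  have hA := areaSq_pos (pd ex u p) (pd ey u p)
  have h : ‖graphNormal e u p‖ ^ 2 = 1 := by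
    rw [← real_inner_self_eq_norm_sq, inner_eq_sum e, h0, h1, h2]
    have hs : (Real.sqrt (areaSq (pd ex u p) (pd ey u p)))⁻¹ ^ 2
        = (areaSq (pd ex u p) (pd ey u p))⁻¹ := by
      rw [inv_pow, Real.sq_sqrt hA.le]
    have : (Real.sqrt (areaSq (pd ex u p) (pd ey u p)))⁻¹ ^ 2 * areaSq (pd ex u p) (pd ey u p)
        = 1 := by
      rw [hs, inv_mul_cancel₀ hA.ne']
    rw [← this, areaSq]
    ring
  exact (pow_eq_one_iff_of_nonneg (norm_nonneg _) two_ne_zero).1 h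

omit [ChartedSpace (EuclideanSpace ℝ (Fin 2)) M] in
lemma IsGraphAt.slice {e : OrthonormalBasis (Fin 3) ℝ E3} {x : M} {t : ℝ}
    (h : IsGraphAt e X u (x, t)) :
    (fun y => inner ℝ (e 2) (X t y)) =ᶠ[𝓝 x]
      fun y => u (inner ℝ (e 0) (X t y), inner ℝ (e 1) (X t y), t) := by
  have hc : Continuous fun y : M => (y, t) := by fun_prop
  exact (hc.tendsto x).eventually h

/-- The tangent plane of a graph. -/
lemma IsGraphAt.inner_diff {e : OrthonormalBasis (Fin 3) ℝ E3} {x : M} {t : ℝ}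
    (h : IsGraphAt e X u (x, t)) (hd : MDifferentiableAt (𝓡 2) 𝓘(ℝ, E3) (X t) x)
    (hu : DifferentiableAt ℝ u (basePoint e X (x, t))) (v : TangentSpace (𝓡 2) x) :
    inner ℝ (e 2) (diff (X t) x v)
      = pd ex u (basePoint e X (x, t)) * inner ℝ (e 0) (diff (X t) x v)
        + pd ey u (basePoint e X (x, t)) * inner ℝ (e 1) (diff (X t) x v) := by
  have h1 := mvfderiv_congr h.slice v
  have d1 : HasFDerivAt (fun w : E3 => inner ℝ (e 2) w) (innerSL ℝ (e 2)) (X t x) :=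
    (innerSL ℝ (e 2)).hasFDerivAt
  have d2 : HasFDerivAt (fun w : E3 => u (inner ℝ (e 0) w, inner ℝ (e 1) w, t))
      ((fderiv ℝ u (basePoint e X (x, t))).comp (toPlane e)) (X t x) :=
    hu.hasFDerivAt.comp (X t x) (hasFDerivAt_toPlane e t (X t x))
  rw [mvfderiv_comp_apply' (g := fun w : E3 => inner ℝ (e 2) w) d1.differentiableAt hd v,
    mvfderiv_comp_apply' (g := fun w : E3 => u (inner ℝ (e 0) w, inner ℝ (e 1) w, t))
      d2.differentiableAt hd v, d1.fderiv, d2.fderiv] at h1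
  rw [ContinuousLinearMap.comp_apply, toPlane_apply, map_add, map_smul, map_smul, smul_eq_mul,
    smul_eq_mul] at h1
  rw [pd, pd]
  have h1' : inner ℝ (e 2) (diff (X t) x v) = _ := h1
  rw [h1']
  ring

lemma IsGraphAt.inner_diff_graphNormal {e : OrthonormalBasis (Fin 3) ℝ E3} {x : M} {t : ℝ}
    (h : IsGraphAt e X u (x, t)) (hd : MDifferentiableAt (𝓡 2) 𝓘(ℝ, E3) (X t) x)
    (hu : DifferentiableAt ℝ u (basePoint e X (x, t))) (v : TangentSpace (𝓡 2) x) :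
    inner ℝ (diff (X t) x v) (graphNormal e u (basePoint e X (x, t))) = 0 := by
  obtain ⟨h0, h1, h2⟩ := inner_graphNormal (u := u) e (basePoint e X (x, t))
  rw [inner_eq_sum e, h0, h1, h2, h.inner_diff hd hu v]
  ring

variable [IsManifold (𝓡 2) ∞ M]

/-- The outer normal of a graph is the downward normal as soon as it points downwards. -/
lemma IsGraphAt.outerUnitNormal_eq {e : OrthonormalBasis (Fin 3) ℝ E3} {x : M} {t : ℝ}
    (hX : IsSolution α T X) (ht : t ∈ Ico 0 T) (h : IsGraphAt e X u (x, t))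
    (hu : DifferentiableAt ℝ u (basePoint e X (x, t)))
    (hneg : inner ℝ (e 2) (outerUnitNormal (X t) x) < 0) :
    outerUnitNormal (X t) x = graphNormal e u (basePoint e X (x, t)) := by
  have hd := hX.mdifferentiable ht
  have hν := (hX.strictlyConvex t ht).outerUnitNormal_spec hd x
  rcases eq_or_eq_neg_of_unit_normal (finrank_tangentSpace x)
    (A := (diff (X t) x : TangentSpace (𝓡 2) x →ₗ[ℝ] E3)) ((hX.strictlyConvex t ht).immersion x)
    (norm_graphNormal (u := u) e (basePoint e X (x, t))) (h.inner_diff_graphNormal (hd x) hu)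
    hν.norm_eq_one hν.orthogonal with h' | h'
  · exact h'
  · obtain ⟨-, -, h2⟩ := inner_graphNormal (u := u) e (basePoint e X (x, t))
    rw [h', inner_neg_right, h2, neg_neg] at hneg
    have : 0 < (Real.sqrt (areaSq (pd ex u (basePoint e X (x, t)))
      (pd ey u (basePoint e X (x, t)))))⁻¹ := inv_pos.2 (Real.sqrt_pos.2 (areaSq_pos _ _))
    linarith

omit [IsManifold (𝓡 2) ∞ M] in
/-- The second fundamental form of a graph is its Hessian divided by `√(1 + |Du|²)`. -/
lemma IsGraphAt.secondFundamentalForm_eq {e : OrthonormalBasis (Fin 3) ℝ E3} {x : M} {t : ℝ}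
    (hX : IsSolution α T X) (ht : t ∈ Ico 0 T) (h : IsGraphAt e X u (x, t))
    (hu : ContDiffAt ℝ 2 u (basePoint e X (x, t)))
    (hν : ∀ᶠ q in 𝓝 (x, t), outerUnitNormal (X q.2) q.1 = graphNormal e u (basePoint e X q))
    (v w : TangentSpace (𝓡 2) x) :
    secondFundamentalForm (X t) x v w
      = (Real.sqrt (areaSq (pd ex u (basePoint e X (x, t))) (pd ey u (basePoint e X (x, t)))))⁻¹ *
        (pd ex (pd ex u) (basePoint e X (x, t))
            * (inner ℝ (e 0) (diff (X t) x v) * inner ℝ (e 0) (diff (X t) x w))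
          + pd ex (pd ey u) (basePoint e X (x, t))
            * (inner ℝ (e 0) (diff (X t) x v) * inner ℝ (e 1) (diff (X t) x w)
              + inner ℝ (e 1) (diff (X t) x v) * inner ℝ (e 0) (diff (X t) x w))
          + pd ey (pd ey u) (basePoint e X (x, t))
            * (inner ℝ (e 1) (diff (X t) x v) * inner ℝ (e 1) (diff (X t) x w))) := by
  have hd := hX.mdifferentiable ht x
  have hu1 : DifferentiableAt ℝ u (basePoint e X (x, t)) := hu.differentiableAt (by norm_num)
  have htan := h.inner_diff hd hu1 w
  have hcomm := pd_comm ex ey hu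
  set p := basePoint e X (x, t)
  have hu' : ContDiffAt ℝ ((1 + 1 : ℕ) : ℕ∞ω) u p := by exact_mod_cast hu
  have dx : DifferentiableAt ℝ (pd ex u) p := (contDiffAt_pd ex hu').differentiableAt (by simp)
  have dy : DifferentiableAt ℝ (pd ey u) p := (contDiffAt_pd ey hu').differentiableAt (by simp)
  have hA := areaSq_pos (pd ex u p) (pd ey u p)
  -- the derivative of the graph normal, up to multiples of the normal
  have hρ : DifferentiableAt ℝ
      (fun p => (Real.sqrt (areaSq (pd ex u p) (pd ey u p)))⁻¹) p := by
    have h1 : DifferentiableAt ℝ (fun p => areaSq (pd ex u p) (pd ey u p)) p :=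
      ((dx.mul dx).add (dy.mul dy)).const_add 1
    exact (h1.sqrt hA.ne').inv (Real.sqrt_pos.2 hA).ne'
  have hm := ((dx.hasFDerivAt.smul_const (e 0)).add (dy.hasFDerivAt.smul_const (e 1))).sub_const
    (e 2)
  have hN : HasFDerivAt (graphNormal e u) _ p := hρ.hasFDerivAt.smul hm
  have hF : HasFDerivAt (fun w : E3 => graphNormal e u (inner ℝ (e 0) w, inner ℝ (e 1) w, t))
      _ (X t x) := HasFDerivAt.comp (g := graphNormal e u)
    (f := fun w : E3 => ((inner ℝ (e 0) w, inner ℝ (e 1) w, t) : ℝ × ℝ × ℝ)) (X t x) hN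
    (hasFDerivAt_toPlane e t (X t x))
  have hslice : outerUnitNormal (X t) =ᶠ[𝓝 x]
      fun y => graphNormal e u (inner ℝ (e 0) (X t y), inner ℝ (e 1) (X t y), t) := by
    have hc : Continuous fun y : M => (y, t) := by fun_prop
    exact (hc.tendsto x).eventually hν
  rw [secondFundamentalForm, diff, mvfderiv_congr hslice v,
    mvfderiv_comp_apply' (g := fun w : E3 => graphNormal e u (inner ℝ (e 0) w, inner ℝ (e 1) w, t))
      hF.differentiableAt hd v, hF.fderiv]
  have hm0 : inner ℝ (pd ex u p • e 0 + pd ey u p • e 1 - e 2) (diff (X t) x w) = 0 := by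
    simp only [inner_sub_left, inner_add_left, real_inner_smul_left]
    rw [htan]
    ring
  rw [ContinuousLinearMap.comp_apply, toPlane_apply]
  obtain ⟨a, ha⟩ : ∃ a, a = inner ℝ (e 0) (diff (X t) x v) := ⟨_, rfl⟩
  obtain ⟨b, hb⟩ : ∃ b, b = inner ℝ (e 1) (diff (X t) x v) := ⟨_, rfl⟩
  rw [← ha, ← hb]
  simp only [add_apply, smul_apply, ContinuousLinearMap.smulRight_apply, inner_add_left,
    real_inner_smul_left, hm0, mul_zero, add_zero, map_add, map_smul]
  have e1 : fderiv ℝ (pd ex u) p ex = pd ex (pd ex u) p := rfl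
  have e2 : fderiv ℝ (pd ex u) p ey = pd ex (pd ey u) p := hcomm.symm
  have e3 : fderiv ℝ (pd ey u) p ex = pd ex (pd ey u) p := rfl
  have e4 : fderiv ℝ (pd ey u) p ey = pd ey (pd ey u) p := rfl
  rw [e1, e2, e3, e4]
  ring

end GaussFlow

namespace GaussFlow

open Filter Topology

variable {M : Type*} [TopologicalSpace M] [ChartedSpace (EuclideanSpace ℝ (Fin 2)) M]
  [IsManifold (𝓡 2) ∞ M] {α T : ℝ} {X : ℝ → M → E3} {u : ℝ × ℝ × ℝ → ℝ}

omit [IsManifold (𝓡 2) ∞ M] in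
/-- A tangent vector with prescribed coordinates in the base plane. -/
lemma IsGraphAt.exists_tangent {e : OrthonormalBasis (Fin 3) ℝ E3} {x : M} {t : ℝ}
    (hX : IsSolution α T X) (ht : t ∈ Ico 0 T) (h : IsGraphAt e X u (x, t))
    (hu : DifferentiableAt ℝ u (basePoint e X (x, t))) (a b : ℝ) :
    ∃ v : TangentSpace (𝓡 2) x, inner ℝ (e 0) (diff (X t) x v) = a ∧
      inner ℝ (e 1) (diff (X t) x v) = b := by
  have hd := hX.mdifferentiable ht x
  let P : TangentSpace (𝓡 2) x →ₗ[ℝ] ℝ × ℝ :=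
    (((innerSL ℝ (e 0)).prod (innerSL ℝ (e 1))).comp (diff (X t) x) :
      TangentSpace (𝓡 2) x →L[ℝ] ℝ × ℝ)
  have hP : ∀ v, P v = (inner ℝ (e 0) (diff (X t) x v), inner ℝ (e 1) (diff (X t) x v)) :=
    fun v => rfl
  have hinj : Function.Injective P := by
    refine (injective_iff_map_eq_zero P).2 fun v hv => ?_
    rw [hP, Prod.mk_eq_zero] at hv
    have h2 := h.inner_diff hd hu v
    rw [hv.1, hv.2, mul_zero, mul_zero, add_zero] at h2
    have h0 : inner ℝ (diff (X t) x v) (diff (X t) x v) = 0 := by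
      rw [inner_eq_sum e, hv.1, hv.2, h2]
      ring
    rw [inner_self_eq_zero] at h0
    exact (hX.strictlyConvex t ht).immersion x (by rw [h0, map_zero])
  have hsurj : Function.Surjective P :=
    (LinearMap.injective_iff_surjective_of_finrank_eq_finrank
      (by rw [finrank_tangentSpace]; simp)).1 hinj
  obtain ⟨v, hv⟩ := hsurj (a, b)
  rw [hP, Prod.mk.injEq] at hv
  exact ⟨v, hv⟩

/-- The classical formulas for the curvatures of a graph, cleared of denominators. The equality of
the outer and the graph normal is needed near `x`, since the second fundamental form involves the
derivative of the normal. -/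
lemma IsGraphAt.curvatures {e : OrthonormalBasis (Fin 3) ℝ E3} {x : M} {t : ℝ}
    (hX : IsSolution α T X) (ht : t ∈ Ico 0 T) (h : IsGraphAt e X u (x, t))
    (hu : ContDiffAt ℝ 2 u (basePoint e X (x, t)))
    (hν : ∀ᶠ q in 𝓝 (x, t), outerUnitNormal (X q.2) q.1 = graphNormal e u (basePoint e X q))
    {W : ℝ} (hW : W = areaSq (pd ex u (basePoint e X (x, t))) (pd ey u (basePoint e X (x, t)))) :
    gaussCurvature (X t) x * W ^ 2 = onJet (fun _ _ => hessDet) u (basePoint e X (x, t)) ∧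
      (meanCurvature (X t) x ^ 2 - 4 * gaussCurvature (X t) x) * W ^ 3
        = onJet discNum u (basePoint e X (x, t)) := by
  have hu1 : DifferentiableAt ℝ u (basePoint e X (x, t)) := hu.differentiableAt (by norm_num)
  have htan := h.inner_diff (hX.mdifferentiable ht x) hu1
  have hff := h.secondFundamentalForm_eq hX ht hu hν
  obtain ⟨v, hv0, hv1⟩ := h.exists_tangent hX ht hu1 1 0
  obtain ⟨w, hw0, hw1⟩ := h.exists_tangent hX ht hu1 0 1
  simp only [onJet, discNum, meanNum, hessDet]
  rw [← hW] at hff ⊢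
  set p := basePoint e X (x, t)
  have hWp : 0 < W := hW ▸ areaSq_pos _ _
  set ρ := (Real.sqrt W)⁻¹ with hρ
  have hρ2 : ρ ^ 2 * W = 1 := by rw [hρ, inv_pow, Real.sq_sqrt hWp.le, inv_mul_cancel₀ hWp.ne']
  have hv2 := htan v
  have hw2 := htan w
  have f11 := hff v v
  have f12 := hff v w
  have f21 := hff w v
  have f22 := hff w w
  rw [hv0, hv1] at hv2
  rw [hw0, hw1] at hw2
  simp only [hv0, hv1, hw0, hw1] at f11 f12 f21 f22
  have g11 : inner ℝ (diff (X t) x v) (diff (X t) x v) = 1 + pd ex u p ^ 2 := by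
    rw [inner_eq_sum e, hv0, hv1, hv2]; ring
  have g12 : inner ℝ (diff (X t) x v) (diff (X t) x w) = pd ex u p * pd ey u p := by
    rw [inner_eq_sum e, hv0, hv1, hv2, hw0, hw1, hw2]; ring
  have g22 : inner ℝ (diff (X t) x w) (diff (X t) x w) = 1 + pd ey u p ^ 2 := by
    rw [inner_eq_sum e, hw0, hw1, hw2]; ring
  have hdet : (1 + pd ex u p ^ 2) * (1 + pd ey u p ^ 2) - (pd ex u p * pd ey u p) ^ 2 = W := by
    rw [hW, areaSq]; ring
  obtain ⟨c1, c2, -, -, -⟩ := curvatures_of_frame (hX.strictlyConvex t ht) (hX.mdifferentiable ht)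
    (hX.mdifferentiableAt_normal ht x) (v₁ := v) (v₂ := w) g11 g12 g22
    (h11 := ρ * pd ex (pd ex u) p) (h12 := ρ * pd ex (pd ey u) p) (h22 := ρ * pd ey (pd ey u) p)
    (f11.trans (by ring)) (f12.trans (by ring)) (f21.trans (by ring)) (f22.trans (by ring))
    (by rw [hdet]; exact hWp)
  rw [hdet] at c1 c2
  have hK : gaussCurvature (X t) x * W ^ 2
      = pd ex (pd ex u) p * pd ey (pd ey u) p - pd ex (pd ey u) p * pd ex (pd ey u) p := by
    linear_combination W * c2 + (pd ex (pd ex u) p * pd ey (pd ey u) p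
      - pd ex (pd ey u) p * pd ex (pd ey u) p) * hρ2
  refine ⟨hK, ?_⟩
  have hH : meanCurvature (X t) x * W = ρ * ((1 + pd ey u p * pd ey u p) * pd ex (pd ex u) p
      + (1 + pd ex u p * pd ex u p) * pd ey (pd ey u) p
      - 2 * (pd ex u p * pd ey u p * pd ex (pd ey u) p)) := by
    rw [c1]; ring
  have hH2 : meanCurvature (X t) x ^ 2 * W ^ 3
      = ((1 + pd ey u p * pd ey u p) * pd ex (pd ex u) p
      + (1 + pd ex u p * pd ex u p) * pd ey (pd ey u) p
      - 2 * (pd ex u p * pd ey u p * pd ex (pd ey u) p)) ^ 2 := by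
    have : meanCurvature (X t) x ^ 2 * W ^ 3 = (meanCurvature (X t) x * W) ^ 2 * W := by ring
    rw [this, hH, mul_pow, mul_right_comm, hρ2, one_mul]
  rw [sub_mul, hH2]
  linear_combination -4 * W * hK

/-- The pinching quantity of a graph. Away from umbilic points it is positive, and its logarithm is
a smooth function of the first and second derivatives. -/
lemma IsGraphAt.pinching_eq_exp {e : OrthonormalBasis (Fin 3) ℝ E3} {x : M} {t : ℝ}
    (hX : IsSolution α T X) (ht : t ∈ Ico 0 T) (h : IsGraphAt e X u (x, t))
    (hu : ContDiffAt ℝ 2 u (basePoint e X (x, t)))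
    (hν : ∀ᶠ q in 𝓝 (x, t), outerUnitNormal (X q.2) q.1 = graphNormal e u (basePoint e X q))
    (hpos : 0 < pinching α (X t) x) :
    pinching α (X t) x = Real.exp (onJet (logPinch (α / 2)) u (basePoint e X (x, t))) := by
  obtain ⟨W, hW⟩ : ∃ W, W = areaSq (pd ex u (basePoint e X (x, t)))
    (pd ey u (basePoint e X (x, t))) := ⟨_, rfl⟩
  obtain ⟨hK, hR⟩ := h.curvatures hX ht hu hν hW
  have hWp : 0 < W := hW ▸ areaSq_pos _ _
  obtain ⟨hK0, -, hp, -⟩ := hX.curvature_facts ht x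
  rw [hp α] at hpos ⊢
  have hKα : 0 < gaussCurvature (X t) x ^ (α - 2) := Real.rpow_pos_of_pos hK0 _
  have hR0 : 0 < meanCurvature (X t) x ^ 2 - 4 * gaussCurvature (X t) x :=
    pos_of_mul_pos_left hpos hKα.le
  simp only [onJet] at hK hR ⊢
  rw [logPinch, ← hK, ← hR, ← hW, Real.log_mul hR0.ne' (by positivity),
    Real.log_mul hK0.ne' (by positivity), Real.log_pow, Real.log_pow,
    Real.rpow_def_of_pos hK0]
  nth_rewrite 1 [← Real.exp_log hR0]
  rw [← Real.exp_add]
  congr 1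
  push_cast
  ring

/-- The equation satisfied by the height function `u` of the flow. The surface point `X · x` moves
in the normal direction, so its base point moves too, and the chain rule along the curve
`τ ↦ basePoint e X (x, τ)` leaves the vertical speed `√(1 + |Du|²) K ^ (α / 2)` for the time derivative
of `u`. -/
lemma IsGraphAt.time_derivative {e : OrthonormalBasis (Fin 3) ℝ E3} {x : M} {t : ℝ}
    (hX : IsSolution α T X) (ht : t ∈ Ioo 0 T) (h : IsGraphAt e X u (x, t))
    (hu : ContDiffAt ℝ 2 u (basePoint e X (x, t)))
    (hν : ∀ᶠ q in 𝓝 (x, t), outerUnitNormal (X q.2) q.1 = graphNormal e u (basePoint e X q)) :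
    pd et u (basePoint e X (x, t))
      = Real.exp (onJet (logSpeed (α / 2)) u (basePoint e X (x, t))) := by
  have ht' : t ∈ Ico 0 T := ⟨ht.1.le, ht.2⟩
  obtain ⟨W, hW⟩ : ∃ W, W = areaSq (pd ex u (basePoint e X (x, t)))
    (pd ey u (basePoint e X (x, t))) := ⟨_, rfl⟩
  obtain ⟨hK, -⟩ := h.curvatures hX ht' hu hν hW
  have hWp : 0 < W := hW ▸ areaSq_pos _ _
  obtain ⟨hK0, -⟩ := hX.curvature_facts ht' x
  have hX' : HasDerivAt (fun τ => X τ x)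
      (-((gaussCurvature (X t) x) ^ (α / 2)) • outerUnitNormal (X t) x) t :=
    (hX.flow t ht' x).hasDerivAt (Ico_mem_nhds ht.1 ht.2)
  set V := -((gaussCurvature (X t) x) ^ (α / 2)) • outerUnitNormal (X t) x with hV
  have hc : ∀ i, HasDerivAt (fun τ => inner ℝ (e i) (X τ x)) (inner ℝ (e i) V) t := fun i =>
    (innerSL ℝ (e i)).hasFDerivAt.comp_hasDerivAt t hX'
  have hu1 : DifferentiableAt ℝ u (basePoint e X (x, t)) := hu.differentiableAt (by norm_num)
  have hcurve : HasDerivAt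
      (fun τ => ((inner ℝ (e 0) (X τ x), inner ℝ (e 1) (X τ x), τ) : ℝ × ℝ × ℝ))
      (inner ℝ (e 0) V, inner ℝ (e 1) V, 1) t := (hc 0).prodMk ((hc 1).prodMk (hasDerivAt_id t))
  have hcomp : HasDerivAt (fun τ => u (inner ℝ (e 0) (X τ x), inner ℝ (e 1) (X τ x), τ))
      (fderiv ℝ u (basePoint e X (x, t)) (inner ℝ (e 0) V, inner ℝ (e 1) V, 1)) t :=
    HasFDerivAt.comp_hasDerivAt (l := u) (f := fun τ => ((inner ℝ (e 0) (X τ x),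
      inner ℝ (e 1) (X τ x), τ) : ℝ × ℝ × ℝ)) t hu1.hasFDerivAt hcurve
  have heq : (fun τ => inner ℝ (e 2) (X τ x)) =ᶠ[𝓝 t]
      fun τ => u (inner ℝ (e 0) (X τ x), inner ℝ (e 1) (X τ x), τ) := by
    have hc : Continuous fun τ : ℝ => (x, τ) := by fun_prop
    exact (hc.tendsto t).eventually h
  have hder := (hc 2).unique (hcomp.congr_of_eventuallyEq heq)
  have hvec : ((inner ℝ (e 0) V, inner ℝ (e 1) V, 1) : ℝ × ℝ × ℝ)
      = inner ℝ (e 0) V • ex + inner ℝ (e 1) V • ey + et := by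
    simp [ex, ey, et]
  rw [hvec, map_add, map_add, map_smul, map_smul] at hder
  obtain ⟨n0, n1, n2⟩ := inner_graphNormal (u := u) e (basePoint e X (x, t))
  rw [← hW] at n0 n1 n2
  rw [hV, hν.self_of_nhds] at hder
  simp only [inner_smul_right, n0, n1, n2, smul_eq_mul] at hder
  set p := basePoint e X (x, t)
  set ρ := (Real.sqrt W)⁻¹ with hρ
  have hs : 0 < Real.sqrt W := Real.sqrt_pos.2 hWp
  have hρW : ρ * W = Real.sqrt W := by
    rw [hρ, inv_mul_eq_div, Real.div_sqrt]
  have hWd : W = 1 + (pd ex u p * pd ex u p + pd ey u p * pd ey u p) := hW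
  have hspeed : pd et u p = gaussCurvature (X t) x ^ (α / 2) * Real.sqrt W := by
    have hder' : -(gaussCurvature (X t) x ^ (α / 2)) * -ρ
      = -(gaussCurvature (X t) x ^ (α / 2)) * (ρ * pd ex u p) * pd ex u p
        + -(gaussCurvature (X t) x ^ (α / 2)) * (ρ * pd ey u p) * pd ey u p + pd et u p := hder
    rw [← hρW]
    linear_combination -hder' - gaussCurvature (X t) x ^ (α / 2) * ρ * hWd
  simp only [onJet] at hK ⊢
  rw [hspeed, logSpeed, ← hK, ← hW, Real.log_mul hK0.ne' (by positivity), Real.log_pow,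
    Real.rpow_def_of_pos hK0]
  nth_rewrite 1 [← Real.exp_log hs]
  rw [← Real.exp_add, Real.log_sqrt hWp.le]
  congr 1
  push_cast
  ring

end GaussFlow

namespace GaussFlow

open Filter Topology

variable {M : Type*} [TopologicalSpace M] [ChartedSpace (EuclideanSpace ℝ (Fin 2)) M]
  [IsManifold (𝓡 2) ∞ M] {α T : ℝ} {X : ℝ → M → E3}

/-! ### The graph over a tangent plane -/

lemma finrank_plane_time :
    Module.finrank ℝ (EuclideanSpace ℝ (Fin 2) × ℝ) = Module.finrank ℝ (ℝ × ℝ × ℝ) := by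
  simp

/-- At positive times the flow is locally the graph of a smooth function over the tangent plane,
jointly in space and time, and the base points fill a neighbourhood. The inverse function theorem
applies to the base point as a function of the chart coordinates and time: its derivative is
injective because a tangent vector of the surface without components along the tangent
plane vanishes. -/
theorem IsSolution.exists_graph (hX : IsSolution α T X) {t : ℝ} (ht : t ∈ Ioo 0 T) {x : M}
    (e : OrthonormalBasis (Fin 3) ℝ E3) (he : outerUnitNormal (X t) x = -e 2) :
    ∃ u : ℝ × ℝ × ℝ → ℝ, ContDiffAt ℝ 5 u (basePoint e X (x, t)) ∧ IsGraphAt e X u (x, t) ∧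
      𝓝 (basePoint e X (x, t)) ≤ map (basePoint e X) (𝓝 (x, t)) := by
  have ht' : t ∈ Ico 0 T := ⟨ht.1.le, ht.2⟩
  set φ := extChartAt (𝓡 2) x with hφ
  set Y := inChart X x with hY
  have hUo : IsOpen φ.target := isOpen_extChartAt_target x
  have hy : φ x ∈ φ.target := mem_extChartAt_target x
  have hS : φ.target ×ˢ Ico 0 T ∈ 𝓝 (φ x, t) :=
    prod_mem_nhds (hUo.mem_nhds hy) (Ico_mem_nhds ht.1 ht.2)
  have hYc : ContDiffAt ℝ 5 Y (φ x, t) :=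
    ((hX.contDiffOn_inChart x).contDiffAt hS).of_le ENat.LEInfty.out
  have hYx : Y (φ x, t) = X t x := by simp only [hY, inChart, hφ, extChartAt_to_inv]
  -- the projection of the surface to the plane, together with time
  let Ψ : EuclideanSpace ℝ (Fin 2) × ℝ → ℝ × ℝ × ℝ := fun p =>
    (inner ℝ (e 0) (Y p), inner ℝ (e 1) (Y p), p.2)
  have hΨc : ContDiffAt ℝ 5 Ψ (φ x, t) :=
    ((contDiffAt_const.inner ℝ hYc)).prodMk
      ((contDiffAt_const.inner ℝ hYc).prodMk contDiffAt_snd)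
  have hΨx : Ψ (φ x, t) = basePoint e X (x, t) := by
    simp only [Ψ, hYx, basePoint]
  have hYd : HasFDerivAt Y (fderiv ℝ Y (φ x, t)) (φ x, t) :=
    (hYc.differentiableAt (by simp)).hasFDerivAt
  let D : EuclideanSpace ℝ (Fin 2) × ℝ →L[ℝ] ℝ × ℝ × ℝ :=
    ((innerSL ℝ (e 0)).comp (fderiv ℝ Y (φ x, t))).prod
      (((innerSL ℝ (e 1)).comp (fderiv ℝ Y (φ x, t))).prod
        (ContinuousLinearMap.snd ℝ (EuclideanSpace ℝ (Fin 2)) ℝ))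
  have hΨd : HasFDerivAt Ψ D (φ x, t) :=
    ((innerSL ℝ (e 0)).hasFDerivAt.comp _ hYd).prodMk
      (((innerSL ℝ (e 1)).hasFDerivAt.comp _ hYd).prodMk hasFDerivAt_snd)
  have hinj : Function.Injective D := by
    refine (injective_iff_map_eq_zero D).2 ?_
    rintro ⟨w, τ⟩ hw
    have hw' : ((inner ℝ (e 0) (fderiv ℝ Y (φ x, t) (w, τ)),
      inner ℝ (e 1) (fderiv ℝ Y (φ x, t) (w, τ)), τ) : ℝ × ℝ × ℝ) = 0 := hw
    simp only [Prod.mk_eq_zero] at hw'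
    obtain ⟨h0, h1, rfl⟩ := hw'
    obtain ⟨L, hL, hLX, -⟩ := hX.exists_frame (x₀ := x) hy ht'
    have hspat : fderiv ℝ Y (φ x, t) (w, 0) = diff (X t) (φ.symm (φ x)) (L w) := by
      rw [hLX, spat, fderivWithin_of_mem_nhds hS]
    have hxx : φ.symm (φ x) = x := extChartAt_to_inv x
    have h2 : inner ℝ (e 2) (fderiv ℝ Y (φ x, t) (w, 0)) = 0 := by
      have ho := ((hX.strictlyConvex t ht').outerUnitNormal_spec (hX.mdifferentiable ht')
        (φ.symm (φ x))).orthogonal (L w)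
      rw [← hspat, hxx, he, inner_neg_right, real_inner_comm] at ho
      linarith
    have h3 : fderiv ℝ Y (φ x, t) (w, 0) = 0 := by
      rw [← inner_self_eq_zero (𝕜 := ℝ), inner_eq_sum e, h0, h1, h2]
      ring
    rw [hspat, map_eq_zero_iff _ ((hX.strictlyConvex t ht').immersion _),
      map_eq_zero_iff L hL.1] at h3
    rw [h3]
    rfl
  let E : (EuclideanSpace ℝ (Fin 2) × ℝ) ≃L[ℝ] (ℝ × ℝ × ℝ) :=
    (LinearEquiv.ofInjectiveOfFinrankEq D.toLinearMap hinj
      finrank_plane_time).toContinuousLinearEquiv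
  have hED : (E : EuclideanSpace ℝ (Fin 2) × ℝ →L[ℝ] ℝ × ℝ × ℝ) = D := by
    ext w <;> rfl
  have hΨd' : HasFDerivAt Ψ (E : EuclideanSpace ℝ (Fin 2) × ℝ →L[ℝ] ℝ × ℝ × ℝ) (φ x, t) := by
    rw [hED]; exact hΨd
  have hstrict := hΨc.hasStrictFDerivAt' hΨd' (by simp)
  have hloc : ContDiffAt ℝ 5 (hΨc.localInverse hΨd' (by simp)) (Ψ (φ x, t)) :=
    hΨc.to_localInverse hΨd' (by simp)
  have hleft : ∀ᶠ p in 𝓝 (φ x, t), hΨc.localInverse hΨd' (by simp) (Ψ p) = p :=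
    hstrict.eventually_left_inverse
  have hinv : hΨc.localInverse hΨd' (by simp) (Ψ (φ x, t)) = (φ x, t) := hleft.self_of_nhds
  refine ⟨fun p => inner ℝ (e 2) (Y (hΨc.localInverse hΨd' (by simp) p)), ?_, ?_, ?_⟩
  · rw [← hΨx]
    refine contDiffAt_const.inner ℝ (ContDiffAt.comp (g := Y) (Ψ (φ x, t)) ?_ hloc)
    rw [hinv]
    exact hYc
  · have hc : Tendsto (fun q : M × ℝ => (φ q.1, q.2)) (𝓝 (x, t)) (𝓝 (φ x, t)) :=
      (((continuousAt_extChartAt (I := 𝓡 2) x).comp (x := (x, t)) continuousAt_fst).prodMk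
        continuousAt_snd)
    have hsrc : ∀ᶠ q : M × ℝ in 𝓝 (x, t), q.1 ∈ φ.source :=
      continuous_fst.continuousAt.eventually (extChartAt_source_mem_nhds (I := 𝓡 2) x)
    filter_upwards [hc.eventually hleft, hsrc] with q hq1 hq2
    have hYq : Y (φ q.1, q.2) = X q.2 q.1 := by
      simp only [hY, inChart, ← hφ, φ.left_inv hq2]
    have hΨq : Ψ (φ q.1, q.2) = basePoint e X q := by
      simp only [Ψ, hYq, basePoint]
    rw [← hΨq, hq1, hYq]
  · have hmap := hstrict.map_nhds_eq_of_equiv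
    rw [hΨx] at hmap
    rw [← hmap]
    have hcomp : Ψ = basePoint e X ∘ (fun p : EuclideanSpace ℝ (Fin 2) × ℝ => (φ.symm p.1, p.2)) :=
      rfl
    rw [hcomp, ← Filter.map_map]
    refine Filter.map_mono ?_
    have h1 : ContinuousAt (fun p : EuclideanSpace ℝ (Fin 2) × ℝ => (φ.symm p.1, p.2)) (φ x, t) :=
      (ContinuousAt.comp (g := φ.symm) (f := Prod.fst) (x := (φ x, t))
        (continuousAt_extChartAt_symm (I := 𝓡 2) x) continuousAt_fst).prodMk continuousAt_snd
    have h2 := h1.tendsto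
    simp only [hφ, extChartAt_to_inv] at h2
    exact h2

/-! ### The maximum principle -/

/-- A function of one variable that is maximal from the left has nonnegative derivative. -/
lemma deriv_nonneg_of_left_max {f : ℝ → ℝ} {d : ℝ} (hf : HasDerivAt f d 0)
    (hmax : ∀ᶠ s in 𝓝[<] (0 : ℝ), f s ≤ f 0) : 0 ≤ d := by
  have h := (hasDerivWithinAt_iff_tendsto_slope' (s := Iio 0) (by simp)).1 hf.hasDerivWithinAt
  refine ge_of_tendsto h ?_
  filter_upwards [hmax, self_mem_nhdsWithin] with s hs hs0
  rw [slope_def_field]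
  exact div_nonneg_of_nonpos (by linarith) (by simpa using (mem_Iio.1 hs0).le)

lemma IsSolution.exists_orthonormalBasis (hX : IsSolution α T X) {t : ℝ} (ht : t ∈ Ico 0 T) {x : M}
    {v₁ v₂ : TangentSpace (𝓡 2) x} (h1 : ‖diff (X t) x v₁‖ = 1) (h2 : ‖diff (X t) x v₂‖ = 1)
    (h12 : inner ℝ (diff (X t) x v₁) (diff (X t) x v₂) = 0) :
    ∃ e : OrthonormalBasis (Fin 3) ℝ E3, e 0 = diff (X t) x v₁ ∧ e 1 = diff (X t) x v₂ ∧
      outerUnitNormal (X t) x = -e 2 := by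
  have hν := (hX.strictlyConvex t ht).outerUnitNormal_spec (hX.mdifferentiable ht) x
  have ho : Orthonormal ℝ ![diff (X t) x v₁, diff (X t) x v₂, -outerUnitNormal (X t) x] := by
    have o1 := hν.orthogonal v₁
    have o2 := hν.orthogonal v₂
    have h21 := h12
    have o1' := o1
    have o2' := o2
    rw [real_inner_comm] at h21 o1' o2'
    constructor
    · intro i
      fin_cases i <;> simp [h1, h2, hν.norm_eq_one]
    · intro i j hij
      fin_cases i <;> fin_cases j <;> simp_all
  refine ⟨(basisOfOrthonormalOfCardEqFinrank ho (by simp)).toOrthonormalBasis (by simpa using ho),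
    ?_, ?_, ?_⟩ <;> simp

/-- The pointwise maximum principle: the pinching quantity minus `ε t` has no maximum over the past
at a positive time, unless `ε ≤ 0`. -/
theorem IsSolution.nonpos_of_isMax (hX : IsSolution α T X) (hα : α ∈ Icc (1 : ℝ) 2) {t : ℝ}
    (ht : t ∈ Ioo 0 T) {x : M} (hpos : 0 < pinching α (X t) x) {ε : ℝ}
    (hmax : ∀ᶠ q : M × ℝ in 𝓝 (x, t), q.2 ≤ t →
      pinching α (X q.2) q.1 - ε * q.2 ≤ pinching α (X t) x - ε * t) : ε ≤ 0 := by
  have ht' : t ∈ Ico 0 T := ⟨ht.1.le, ht.2⟩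
  have hnhds : (univ : Set M) ×ˢ Ico 0 T ∈ 𝓝 (x, t) :=
    prod_mem_nhds univ_mem (Ico_mem_nhds ht.1 ht.2)
  obtain ⟨hK0, -, hp, -⟩ := hX.curvature_facts ht' x
  have hne : 0 < meanCurvature (X t) x ^ 2 - 4 * gaussCurvature (X t) x := by
    rw [hp] at hpos
    exact pos_of_mul_pos_left hpos (Real.rpow_pos_of_pos hK0 _).le
  obtain ⟨v₁, v₂, k₁, k₂, hk1, hk2, hk, hn1, hn2, hn12, f11, f12, f22⟩ :=
    hX.exists_principal_frame ht' hne
  obtain ⟨e, he0, he1, he2⟩ := hX.exists_orthonormalBasis ht' hn1 hn2 hn12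
  obtain ⟨u, hu, hgraph, hopen⟩ := hX.exists_graph ht e he2
  -- near `(x, t)` the normal is the downward normal of the graph
  have hXc : ContinuousAt (fun q : M × ℝ => X q.2 q.1) (x, t) :=
    hX.smooth.continuousOn.continuousAt hnhds
  have hbc : ContinuousAt (basePoint e X) (x, t) :=
    (continuousAt_const.inner hXc).prodMk ((continuousAt_const.inner hXc).prodMk
      continuousAt_snd)
  have hdown : ∀ᶠ q : M × ℝ in 𝓝 (x, t), inner ℝ (e 2) (outerUnitNormal (X q.2) q.1) < 0 := by
    have hc : ContinuousAt (fun q : M × ℝ => inner ℝ (e 2) (outerUnitNormal (X q.2) q.1)) (x, t) :=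
      continuousAt_const.inner (hX.continuousOn_normal.continuousAt hnhds)
    refine hc.eventually_lt_const ?_
    simp only [he2, inner_neg_right, real_inner_self_eq_norm_sq, e.norm_eq_one]
    norm_num
  have hint : ∀ᶠ q : M × ℝ in 𝓝 (x, t), q.2 ∈ Ioo 0 T :=
    continuous_snd.continuousAt.eventually (Ioo_mem_nhds ht.1 ht.2)
  have hsm : ∀ᶠ q : M × ℝ in 𝓝 (x, t), ContDiffAt ℝ 2 u (basePoint e X q) :=
    hbc.eventually ((hu.of_le (by norm_num)).eventually (by simp))
  have hgr : ∀ᶠ q : M × ℝ in 𝓝 (x, t), IsGraphAt e X u q := eventually_eventually_nhds.2 hgraph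
  have hnor : ∀ᶠ q : M × ℝ in 𝓝 (x, t),
      outerUnitNormal (X q.2) q.1 = graphNormal e u (basePoint e X q) := by
    filter_upwards [hdown, hint, hsm, hgr] with q h1 h2 h3 h4
    exact h4.outerUnitNormal_eq hX ⟨h2.1.le, h2.2⟩ (h3.differentiableAt (by norm_num)) h1
  have hnor' := eventually_eventually_nhds.2 hnor
  obtain ⟨z, hz⟩ : ∃ z, z = basePoint e X (x, t) := ⟨_, rfl⟩
  have hu2 : ContDiffAt ℝ 2 u (basePoint e X (x, t)) := hsm.self_of_nhds
  -- the jet of `u` at the base point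
  obtain ⟨n0, n1, n2⟩ := inner_graphNormal (u := u) e (basePoint e X (x, t))
  rw [← hnor.self_of_nhds, he2] at n0 n1
  have hρ : (Real.sqrt (areaSq (pd ex u (basePoint e X (x, t)))
      (pd ey u (basePoint e X (x, t)))))⁻¹ ≠ 0 :=
    inv_ne_zero (Real.sqrt_pos.2 (areaSq_pos _ _)).ne'
  have e02 : inner ℝ (e 0) (e 2) = 0 := e.orthonormal.2 (by decide)
  have e12 : inner ℝ (e 1) (e 2) = 0 := e.orthonormal.2 (by decide)
  have e10 : inner ℝ (e 1) (e 0) = 0 := e.orthonormal.2 (by decide)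
  have e01 : inner ℝ (e 0) (e 1) = 0 := e.orthonormal.2 (by decide)
  have e00 : inner ℝ (e 0) (e 0) = (1 : ℝ) := by
    rw [real_inner_self_eq_norm_sq, e.norm_eq_one, one_pow]
  have e11 : inner ℝ (e 1) (e 1) = (1 : ℝ) := by
    rw [real_inner_self_eq_norm_sq, e.norm_eq_one, one_pow]
  rw [inner_neg_right, e02, neg_zero] at n0
  rw [inner_neg_right, e12, neg_zero] at n1
  have hx0 : pd ex u z = 0 := hz ▸ (mul_eq_zero.1 n0.symm).resolve_left hρ
  have hy0 : pd ey u z = 0 := hz ▸ (mul_eq_zero.1 n1.symm).resolve_left hρ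
  have hff := hgraph.secondFundamentalForm_eq hX ht' hu2 hnor
  rw [← hz] at hff
  have hff11 := hff v₁ v₁
  have hff12 := hff v₁ v₂
  have hff22 := hff v₂ v₂
  rw [f11, ← he0, hx0, hy0, e00, e10] at hff11
  rw [f12, ← he0, ← he1, hx0, hy0, e00, e10, e01, e11] at hff12
  rw [f22, ← he1, hx0, hy0, e01, e11] at hff22
  simp only [areaSq, mul_zero, add_zero, Real.sqrt_one, inv_one, one_mul, mul_one, zero_add]
    at hff11 hff12 hff22
  -- the evolution equation and the maximum, in terms of `u`
  have hpde : pd et u =ᶠ[𝓝 z] fun w => Real.exp (onJet (logSpeed (α / 2)) u w) := by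
    rw [hz]
    refine hopen ?_
    rw [mem_map]
    filter_upwards [hint, hsm, hgr, hnor'] with q h1 h2 h3 h4
    exact h3.time_derivative hX h1 h2 h4
  have hposn : ∀ᶠ q : M × ℝ in 𝓝 (x, t), 0 < pinching α (X q.2) q.1 :=
    (hX.continuousOn_pinching.continuousAt hnhds).eventually (lt_mem_nhds hpos)
  set G := onJet (logPinch (α / 2)) u
  have hGmax : ∀ᶠ w in 𝓝 z, w.2.2 ≤ t →
      Real.exp (G w) - ε * w.2.2 ≤ Real.exp (G z) - ε * t := by
    rw [hz]
    refine hopen ?_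
    rw [mem_map]
    -- by `hopen`, points near `z` are base points of surface points near `(x, t)`
    filter_upwards [hint, hsm, hgr, hnor', hposn, hmax] with q h1 h2 h3 h4 h5 h6 h7
    have h8 := h6 h7
    rw [h3.pinching_eq_exp hX ⟨h1.1.le, h1.2⟩ h2 h4 h5,
      hgraph.pinching_eq_exp hX ht' hu2 hnor hpos] at h8
    exact h8
  have hzt : z.2.2 = t := by rw [hz]; rfl
  have hline : ∀ v : ℝ × ℝ × ℝ, Tendsto (fun s : ℝ => z + s • v) (𝓝 0) (𝓝 z) := by
    intro v
    have : Continuous fun s : ℝ => z + s • v := by fun_prop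
    simpa using this.tendsto 0
  have hspace : ∀ v : ℝ × ℝ × ℝ, v.2.2 = 0 → IsLocalMax (fun s : ℝ => G (z + s • v)) 0 := by
    intro v hv
    filter_upwards [(hline v).eventually hGmax] with s hs
    have hs2 : (z + s • v).2.2 = t := by simp [hv, hzt]
    have := hs hs2.le
    rw [hs2] at this
    have h9 : Real.exp (G (z + s • v)) ≤ Real.exp (G z) := by linarith
    simpa using Real.exp_le_exp.1 h9
  obtain ⟨d, hd, hder⟩ := exists_hasDerivAt_logPinch_nonpos (β := α / 2) (hz ▸ hu) hk1 hk2 hk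
    (by linarith [hα.1]) (by linarith [hα.2]) hx0 hy0 hff11.symm hff12.symm hff22.symm hpde
    (hspace ex rfl) (hspace ey rfl)
  have hder2 : HasDerivAt (fun s : ℝ => Real.exp (G (z + s • et)) - ε * s)
      (Real.exp (G (z + (0 : ℝ) • et)) * d - ε * 1) 0 :=
    hder.exp.sub ((hasDerivAt_id (0 : ℝ)).const_mul ε)
  have hleft := deriv_nonneg_of_left_max hder2 (by
    filter_upwards [((hline et).eventually hGmax).filter_mono nhdsWithin_le_nhds,
      self_mem_nhdsWithin] with s hs hs0
    have hs2 : (z + s • et).2.2 = t + s := by simp [et, hzt]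
    have := hs (by rw [hs2]; linarith [mem_Iio.1 hs0])
    rw [hs2] at this
    simp only [zero_smul, add_zero, mul_zero, sub_zero]
    linarith)
  have := mul_nonpos_of_nonneg_of_nonpos (Real.exp_pos (G (z + (0 : ℝ) • et))).le hd
  linarith

end GaussFlow

namespace GaussFlow

open Filter Topology

variable {M : Type*} [TopologicalSpace M] [CompactSpace M]
  [ChartedSpace (EuclideanSpace ℝ (Fin 2)) M] [IsManifold (𝓡 2) ∞ M] {α T : ℝ} {X : ℝ → M → E3}

omit [CompactSpace M] in
lemma IsSolution.pinching_nonneg (hX : IsSolution α T X) {t : ℝ} (ht : t ∈ Ico 0 T) (x : M) :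
    0 ≤ pinching α (X t) x := by
  obtain ⟨hK, hd, hp, -⟩ := hX.curvature_facts ht x
  rw [hp]
  exact mul_nonneg hd (Real.rpow_nonneg hK.le _)

theorem IsSolution.bddAbove_pinching (hX : IsSolution α T X) {t : ℝ} (ht : t ∈ Ico 0 T) :
    BddAbove (range (pinching α (X t))) := by
  have hc : Continuous (pinching α (X t)) := by
    rw [← continuousOn_univ]
    exact hX.continuousOn_pinching.comp (f := fun x : M => (x, t)) (by fun_prop)
      fun x _ => ⟨mem_univ _, ht⟩
  exact (isCompact_range hc).bddAbove

/-- The maximum principle on a time interval `[a, b]`, with the error term `ε (b - a)` that makes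
the maximum strict. -/
theorem IsSolution.pinching_le_iSup_add (hX : IsSolution α T X) (hα : α ∈ Icc (1 : ℝ) 2) {a b : ℝ}
    (ha : 0 ≤ a) (hab : a ≤ b) (hb : b < T) {ε : ℝ} (hε : 0 < ε) (x : M) :
    pinching α (X b) x ≤ (⨆ y : M, pinching α (X a) y) + ε * (b - a) := by
  have hsub : (univ : Set M) ×ˢ Icc a b ⊆ univ ×ˢ Ico 0 T :=
    prod_mono_right fun s hs => ⟨ha.trans hs.1, hs.2.trans_lt hb⟩
  obtain ⟨⟨y, s⟩, ⟨-, hs⟩, hmax⟩ := (isCompact_univ.prod isCompact_Icc).exists_isMaxOn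
    (s := (univ : Set M) ×ˢ Icc a b) ⟨(x, b), mem_univ _, hab, le_rfl⟩
    (f := fun q => pinching α (X q.2) q.1 - ε * q.2)
    ((hX.continuousOn_pinching.mono hsub).sub (by fun_prop))
  have hmax' : ∀ z, ∀ r ∈ Icc a b,
      pinching α (X r) z - ε * r ≤ pinching α (X s) y - ε * s :=
    fun z r hr => hmax (a := (z, r)) ⟨mem_univ _, hr⟩
  have ha' : a ∈ Ico 0 T := ⟨ha, hab.trans_lt hb⟩
  rcases hs.1.eq_or_lt with rfl | has
  · have h1 := hmax' x b ⟨hab, le_rfl⟩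
    have h2 := le_ciSup (hX.bddAbove_pinching ha') y
    linarith
  · exfalso
    have hsT : s ∈ Ioo 0 T := ⟨ha.trans_lt has, hs.2.trans_lt hb⟩
    have hpos : 0 < pinching α (X s) y := by
      have h1 := hmax' y a ⟨le_rfl, hab⟩
      have h2 := hX.pinching_nonneg ha' y
      nlinarith
    refine hε.not_ge (hX.nonpos_of_isMax hα hsT hpos ?_)
    have hev : ∀ᶠ q : M × ℝ in 𝓝 (y, s), a < q.2 :=
      continuousAt_snd.eventually (lt_mem_nhds has)
    filter_upwards [hev] with q hq hqs
    exact hmax' q.1 q.2 ⟨hq.le, hqs.trans hs.2⟩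

end GaussFlow

theorem theorem2p2 {M : Type*} [TopologicalSpace M] [CompactSpace M]
    [ChartedSpace (EuclideanSpace ℝ (Fin 2)) M] [IsManifold (𝓡 2) ∞ M]
    (α : ℝ) (hα : α ∈ Icc (1 : ℝ) 2) (T : ℝ) (X : ℝ → M → GaussFlow.E3)
    (hX : GaussFlow.IsSolution α T X) :
    (∀ t ∈ Ico 0 T, BddAbove (range (GaussFlow.pinching α (X t)))) ∧
      AntitoneOn (fun t => ⨆ x : M, GaussFlow.pinching α (X t) x) (Ico 0 T) := by
  refine ⟨fun t ht => hX.bddAbove_pinching ht, fun a ha b hb hab => ?_⟩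
  rcases isEmpty_or_nonempty M with hM | hM
  · simp [Real.iSup_of_isEmpty]
  · refine ciSup_le fun x => le_of_forall_pos_le_add fun δ hδ => ?_
    have hd : 0 < b - a + 1 := by linarith
    have h := hX.pinching_le_iSup_add hα ha.1 hab hb.2 (div_pos hδ hd) x
    have h' : δ / (b - a + 1) * (b - a) ≤ δ := by
      rw [div_mul_eq_mul_div, div_le_iff₀ hd]
      nlinarith
    linarith
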